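/- **Theorem 2.2.** Let $\beta\in(1,2]$, $\sigma>0$, $c_l,c_u>0$ and $L, m_{2\beta}\in\mathbb R$. There are constants $C,C_1,C_2>0$ depending only on $m_{2\beta},\sigma,\beta,c_l,c_u,L$ such that the following holds for all integers $d\ge1$, $n$ and all $\epsilon\in(0,\tfrac16)$ with $$n\ \ge\ C\,d\,[\log(\epsilon^{-1})+1].$$ *Model.* Let $y_i=\langle \boldsymbol x_i,\boldsymbol\theta^*\rangle+\varepsilon_i$, $1\le i\le n$, with $\boldsymbol\theta^*\in\mathbb R^d$, where the pairs $(y_i,\boldsymbol x_i)\in\mathbb R\times\mathbb R^d$ are independent (not necessarily identically distributed, so that both an i.i.d. design and a deterministic design are allowed), $\mathbb E|\varepsilon_i|^{2\beta}<\infty$, and almost surely $$\mathbb E[\varepsilon_i\mid\boldsymbol x_i]=0,\qquad \mathbb E[\varepsilon_i^2\mid\boldsymbol x_i]=\sigma^2,\qquad \mathbb E[|\varepsilon_i|^{2\beta}\mid\boldsymbol x_i]=m_{2\beta}.$$ Call the design $(\boldsymbol x_1,\dots,\boldsymbol x_n)$ *good* if $\mathbf S_n=\frac1n\sum_{i=1}^n\boldsymbol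 x_i\boldsymbol x_i^T$ is nonsingular with all its eigenvalues in $[c_l,c_u]$, and $\max_{i}\|\boldsymbol x_i\|_2\le L$. *Equations.* Put $$\alpha_1=\sqrt{\frac{\log(d\,n^{\frac1\beta-\frac12}\epsilon^{-1})}{n}},\qquad \alpha_2=\Big(\frac{\log(\epsilon^{-1})}{n}\Big)^{\frac1\beta},$$ and let $\psi_1,\psi_2:\mathbb R\to\mathbb R$ be continuous non-decreasing functions with $\psi_1(0)=\psi_2(0)=0$ and, for all $x\in\mathbb R$, $$-\log\Big(1-x+\frac{x^2}{2}\Big)\le\psi_1(x)\le\log\Big(1+x+\frac{x^2}{2}\Big),\qquad -\log\Big(1-x+\frac{|x|^\beta}{\beta}\Big)\le\psi_2(x)\le\log\Big(1+x+\frac{|x|^\beta}{\beta}\Big).$$ Consider the coupled equations in $(\boldsymbol\theta,v)$ $$\frac1n\sum_{i=1}^n\boldsymbol x_i\,\psi_1\Big(\alpha_1\frac{y_i-\langle\boldsymbol x_i,\boldsymbol\theta\rangle}{v}\Big)=\boldsymbol 0,\qquad \frac1n\sum_{i=1}^n\psi_2\Big(\alpha_2\Big(\frac{(y_i-\langle\boldsymbol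 x_i,\boldsymbol\theta\rangle)^2}{v^2}-1\Big)\Big)=0.$$ *Conclusion.* There is an event $E$ whose conditional probability given the design $(\boldsymbol x_1,\dots,\boldsymbol x_n)$ is at least $1-6\epsilon$ almost surely wherever the design is good (so $\mathbb P(E)\ge1-6\epsilon$ if the design is almost surely good), such that on $E$ the coupled equations have a solution $(\hat{\boldsymbol\theta},\hat v)$ with $$\|\hat{\boldsymbol\theta}-\boldsymbol\theta^*\|_2\le C_1\sigma\sqrt{\frac{d\log(d\,n^{\frac1\beta-\frac12}\epsilon^{-1})}{n}},$$ $$C_2\big(\sqrt d\,\alpha_1+\alpha_2^{\beta-1}\big)<1,\qquad \Big(1+C_2\big(\sqrt d\,\alpha_1+\alpha_2^{\beta-1}\big)\Big)^{-\frac12}\sigma\le\hat v\le\Big(1-C_2\big(\sqrt d\,\alpha_1+\alpha_2^{\beta-1}\big)\Big)^{-\frac12}\sigma.$$ Moreover $$\sqrt d\,\alpha_1+\alpha_2^{\beta-1}=\sqrt{\frac{d\log(d\,n^{\frac1\beta-\frac12}\epsilon^{-1})}{n}}+\Big(\frac{\log(\epsilon^{-1})}{n}\Big)^{\frac{\beta-1}{\beta}}.$$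 -/

import Mathlib

open MeasureTheory ProbabilityTheory

namespace JointRegression

/-- Influence functions of order `β`: continuous non-decreasing functions with a root at `0` and
`-log (1 - x + |x|^β / β) ≤ ψ x ≤ log (1 + x + |x|^β / β)`.
For `1 ≤ β ≤ 2` both arguments of the logarithm are positive for every real `x`. -/
structure IsCatoniFunction (β : ℝ) (ψ : ℝ → ℝ) : Prop where
  continuous : Continuous ψ
  monotone : Monotone ψ
  map_zero : ψ 0 = 0
  lower : ∀ x : ℝ, -Real.log (1 - x + |x| ^ β / β) ≤ ψ x
  upper : ∀ x : ℝ, ψ x ≤ Real.log (1 + x + |x| ^ β / β)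

/-- The empirical Gram matrix `(1/n) ∑ xᵢ xᵢᵀ` of a design `x₁, …, xₙ ∈ ℝᵈ`. -/
noncomputable def gramMatrix {d n : ℕ} (x : Fin n → EuclideanSpace ℝ (Fin d)) :
    Matrix (Fin d) (Fin d) ℝ :=
  (1 / (n : ℝ)) • ∑ i, Matrix.vecMulVec (fun j => x i j) (fun j => x i j)

/-- The conditions on a design: the Gram matrix (a real symmetric matrix) is nonsingular with all
its eigenvalues in `[c_l, c_u]`, and all the design vectors have Euclidean norm at most `L`. -/
structure IsGoodDesign {d n : ℕ} (c_l c_u L : ℝ)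
    (x : Fin n → EuclideanSpace ℝ (Fin d)) : Prop where
  nonsingular : IsUnit (gramMatrix x)
  eigenvalues_mem : spectrum ℝ (gramMatrix x) ⊆ Set.Icc c_l c_u
  norm_le : ∀ i, ‖x i‖ ≤ L

/-- The linear model `yᵢ = ⟨xᵢ, θ⋆⟩ + noiseᵢ` with independent samples `(yᵢ, xᵢ)` whose noise has,
conditionally on `xᵢ`, mean `0`, variance `σ²` and finite absolute moment of order `2β` equal to
`m`. The samples need not be identically distributed, so that a fixed design (constant `xᵢ`) and
an i.i.d. random design are both included. -/
structure IsLinearModel {Ω : Type*} [MeasurableSpace Ω] (μ : Measure Ω) {d n : ℕ}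
    (β σ m : ℝ) (θstar : EuclideanSpace ℝ (Fin d))
    (x : Fin n → Ω → EuclideanSpace ℝ (Fin d)) (noise y : Fin n → Ω → ℝ) : Prop where
  measurable_design : ∀ i, Measurable (x i)
  measurable_noise : ∀ i, Measurable (noise i)
  model : ∀ i ω, y i ω = inner ℝ (x i ω) θstar + noise i ω
  indep : iIndepFun (fun i ω => (y i ω, x i ω)) μ
  integrable_moment : ∀ i, Integrable (fun ω => |noise i ω| ^ (2 * β)) μ
  cond_mean : ∀ i,
    μ[noise i | MeasurableSpace.comap (x i) inferInstance] =ᵐ[μ] fun _ => 0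
  cond_variance : ∀ i,
    μ[fun ω => noise i ω ^ 2 | MeasurableSpace.comap (x i) inferInstance] =ᵐ[μ] fun _ => σ ^ 2
  cond_moment : ∀ i,
    μ[fun ω => |noise i ω| ^ (2 * β) | MeasurableSpace.comap (x i) inferInstance]
      =ᵐ[μ] fun _ => m

/-- `α₁ = √(log (d n^{1/β - 1/2} ε⁻¹) / n)`. -/
noncomputable def alpha₁ (β : ℝ) (d n : ℕ) (ε : ℝ) : ℝ :=
  √(Real.log ((d : ℝ) * (n : ℝ) ^ (1 / β - 1 / 2) * ε⁻¹) / (n : ℝ))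

/-- `α₂ = (log (ε⁻¹) / n)^{1/β}`. -/
noncomputable def alpha₂ (β : ℝ) (n : ℕ) (ε : ℝ) : ℝ :=
  (Real.log ε⁻¹ / (n : ℝ)) ^ (1 / β)

/-- The trend part `(1/n) ∑ ψ₁(a (yᵢ - ⟨xᵢ, θ⟩) / v) xᵢ` of the coupled equations. -/
noncomputable def trendEq {d n : ℕ} (ψ₁ : ℝ → ℝ) (a : ℝ)
    (x : Fin n → EuclideanSpace ℝ (Fin d)) (y : Fin n → ℝ)
    (θ : EuclideanSpace ℝ (Fin d)) (v : ℝ) : EuclideanSpace ℝ (Fin d) :=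
  (1 / (n : ℝ)) • ∑ i, ψ₁ (a * ((y i - inner ℝ (x i) θ) / v)) • x i

/-- The scale part `(1/n) ∑ ψ₂(a ((yᵢ - ⟨xᵢ, θ⟩)² / v² - 1))` of the coupled equations. -/
noncomputable def scaleEq {d n : ℕ} (ψ₂ : ℝ → ℝ) (a : ℝ)
    (x : Fin n → EuclideanSpace ℝ (Fin d)) (y : Fin n → ℝ)
    (θ : EuclideanSpace ℝ (Fin d)) (v : ℝ) : ℝ :=
  (1 / (n : ℝ)) * ∑ i, ψ₂ (a * ((y i - inner ℝ (x i) θ) ^ 2 / v ^ 2 - 1))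

/-- The rate `√d α₁ + α₂^{β - 1}` of the scale estimator. -/
noncomputable def scaleRate (β : ℝ) (d n : ℕ) (ε : ℝ) : ℝ :=
  √(d : ℝ) * alpha₁ β d n ε + alpha₂ β n ε ^ (β - 1)

end JointRegression

open MeasureTheory ProbabilityTheory

namespace JointRegression

/-! Put τ = σ/v and h = θ - θ⋆. For fixed τ the trend equation says that the gradient of a convex
function of h vanishes. The proof finds a root in the ball of radius ρ = C₁ σ √d α₁ and then solves
the scale equation by an intermediate value argument in τ, for τ² in [1 - η, 1 + η] with η = C₂ (√d
α₁ + α₂^(β-1)). The root h need not be unique or continuous in τ, but the roots for a given τ form a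
convex set, and connectedness is enough (`exists_coupled_zero`).

A minimizer over the ball is interior as soon as each h on the sphere admits one p in the ball with
⟨G p, h - p⟩ < 0, where -G is the gradient. Any p close to h/2 will do, so p can be taken from a
finite net and no modulus of continuity of ψ₁ is needed. At net points Chernoff's bound and the
Catoni inequalities keep each coordinate of the trend within O(n α₁²) of its linearization.
Uniformity in τ comes from monotonicity on cells of length α₁. Since α₂^(β-1) ≤ α₁ n^(1/β-1/2), the
number of cells is of order n^(1/β-1/2), which is the factor inside the logarithm. The scale
equation needs only its sign at the two extreme τ, obtained from envelopes over |⟨xᵢ, h⟩| ≤ Bρ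
(`exists_solution_of_event`).

Given the design, the noise is a product of laws with the prescribed moments, so probabilities are
computed for a frozen design (`real_compl_solutionEvent_le`); trend and the two scale signs cost ε
each. A good design forces d c_l ≤ B², so only finitely many dimensions matter and constants may
depend on the nets. -/

/-! ### Freezing the design. -/

/-- The product of Markov kernels `κ i`, the `i`-th one evaluated at the `i`-th coordinate. -/
noncomputable def piKernel {ι E F : Type*} [Fintype ι] [MeasurableSpace E] [MeasurableSpace F]
    (κ : ι → Kernel E F) [∀ i, IsMarkovKernel (κ i)] : Kernel (ι → E) (ι → F) where
  toFun x := Measure.pi fun i => κ i (x i)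
  measurable' := by
    refine Measurable.measure_of_isPiSystem_of_isProbabilityMeasure generateFrom_pi.symm
      (isPiSystem_pi) ?_
    rintro _ ⟨s, hs, rfl⟩
    simp only [Measure.pi_pi]
    exact Finset.measurable_prod _ fun i _ =>
      ((κ i).measurable_coe (hs i (Set.mem_univ i))).comp (measurable_pi_apply i)

lemma piKernel_apply {ι E F : Type*} [Fintype ι] [MeasurableSpace E] [MeasurableSpace F]
    (κ : ι → Kernel E F) [∀ i, IsMarkovKernel (κ i)] (x : ι → E) :
    piKernel κ x = Measure.pi fun i => κ i (x i) := rfl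

instance {ι E F : Type*} [Fintype ι] [MeasurableSpace E] [MeasurableSpace F]
    (κ : ι → Kernel E F) [∀ i, IsMarkovKernel (κ i)] : IsMarkovKernel (piKernel κ) :=
  ⟨fun x => by rw [piKernel_apply]; infer_instance⟩

/-- For independent pairs, the joint law disintegrates into the product of the conditional
distributions. -/
lemma map_prodMk_eq_compProd_piKernel {Ω ι E : Type*} [Fintype ι] [MeasurableSpace Ω]
    [MeasurableSpace E] (μ : Measure Ω) [IsProbabilityMeasure μ]
    {x : ι → Ω → E} {z : ι → Ω → ℝ} (hx : ∀ i, Measurable (x i)) (hz : ∀ i, Measurable (z i))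
    (hind : iIndepFun (fun i ω => (x i ω, z i ω)) μ) :
    μ.map (fun ω => ((fun i => x i ω), (fun i => z i ω))) =
      μ.map (fun ω i => x i ω) ⊗ₘ piKernel fun i => condDistrib (z i) (x i) μ := by
  classical
  have hX : Measurable fun ω i => x i ω := measurable_pi_lambda _ hx
  have hZ : Measurable fun ω i => z i ω := measurable_pi_lambda _ hz
  set κ := fun i => condDistrib (z i) (x i) μ with hκ
  set ρ := μ.map (fun ω i => x i ω) ⊗ₘ piKernel κ with hρ
  let e : (ι → E) × (ι → ℝ) → ι → E × ℝ := fun p i => (p.1 i, p.2 i)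
  let e' : (ι → E × ℝ) → (ι → E) × (ι → ℝ) := fun q => (fun i => (q i).1, fun i => (q i).2)
  have he : Measurable e := by fun_prop
  have he' : Measurable e' := by fun_prop
  -- With the coordinates regrouped into pairs, equality can be tested on boxes. There the kernel
  -- gives a product of functions of the separate xᵢ, whose integral factorizes by independence.
  have key : ρ.map e = Measure.pi fun i => μ.map fun ω => (x i ω, z i ω) := by
    symm
    have : ∀ i, IsProbabilityMeasure (μ.map fun ω => (x i ω, z i ω)) := fun i =>
      Measure.isProbabilityMeasure_map ((hx i).prodMk (hz i)).aemeasurable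
    refine Measure.pi_eq fun s hs => ?_
    have hpi : MeasurableSet (Set.univ.pi s) := MeasurableSet.univ_pi hs
    rw [Measure.map_apply he hpi, hρ, Measure.compProd_apply (he hpi)]
    rw [lintegral_map (by exact Kernel.measurable_kernel_prodMk_left (he hpi)) hX]
    have h1 : ∀ ω, (piKernel κ) (fun i => x i ω)
        (Prod.mk (fun i => x i ω) ⁻¹' (e ⁻¹' Set.univ.pi s)) =
        ∏ i, κ i (x i ω) (Prod.mk (x i ω) ⁻¹' s i) := by
      intro ω
      rw [piKernel_apply, ← Measure.pi_pi]
      congr 1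
    simp only [h1]
    have h2 : ∀ i, Measurable fun u : E => κ i u (Prod.mk u ⁻¹' s i) := fun i =>
      Kernel.measurable_kernel_prodMk_left (hs i)
    have h3 : iIndepFun (fun i ω => κ i (x i ω) (Prod.mk (x i ω) ⁻¹' s i)) μ :=
      hind.comp (fun i (p : E × ℝ) => κ i p.1 (Prod.mk p.1 ⁻¹' s i))
        fun i => (h2 i).comp measurable_fst
    rw [lintegral_prod_eq_prod_lintegral_of_indepFun Finset.univ _ h3
      fun i => (h2 i).comp (hx i)]
    refine Finset.prod_congr rfl fun i _ => ?_
    rw [← compProd_map_condDistrib (hz i).aemeasurable, Measure.compProd_apply (hs i),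
      lintegral_map (h2 i) (hx i)]
  rw [← iIndepFun.map_fun_eq_pi_map (fun i => ((hx i).prodMk (hz i)).aemeasurable) hind] at key
  have := congrArg (Measure.map e') key
  rw [Measure.map_map he' he, Measure.map_map he' (by fun_prop)] at this
  have hid : e' ∘ e = id := rfl
  rw [hid, Measure.map_id] at this
  rw [this]
  rfl

/-- Conditional probabilities given the design are computed by freezing the design. -/
lemma condExp_indicator_eq_pi_condDistrib {Ω ι E : Type*} [Fintype ι] [MeasurableSpace Ω]
    [MeasurableSpace E] (μ : Measure Ω) [IsProbabilityMeasure μ]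
    {x : ι → Ω → E} {z : ι → Ω → ℝ} (hx : ∀ i, Measurable (x i)) (hz : ∀ i, Measurable (z i))
    (hind : iIndepFun (fun i ω => (x i ω, z i ω)) μ) {T : Set ((ι → E) × (ι → ℝ))}
    (hT : MeasurableSet T) :
    μ⟦{ω | ((fun i => x i ω), (fun i => z i ω)) ∈ T} |
        MeasurableSpace.comap (fun ω i => x i ω) inferInstance⟧ =ᵐ[μ]
      fun ω => (Measure.pi fun i => condDistrib (z i) (x i) μ (x i ω)).real
        {w | ((fun i => x i ω), w) ∈ T} := by
  have hX : Measurable fun ω i => x i ω := measurable_pi_lambda _ hx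
  have hZ : Measurable fun ω i => z i ω := measurable_pi_lambda _ hz
  have h1 := condDistrib_ae_eq_of_measure_eq_compProd_of_measurable hX hZ
    (map_prodMk_eq_compProd_piKernel μ hx hz hind)
  have h2 := ae_of_ae_map hX.aemeasurable h1
  have h3 := condExp_prod_ae_eq_integral_condDistrib (μ := μ) (f := T.indicator fun _ => (1 : ℝ)) hX
    hZ.aemeasurable (stronglyMeasurable_const.indicator hT)
    ((integrable_const (1 : ℝ)).indicator ((hX.prodMk hZ) hT))
  refine Filter.EventuallyEq.trans h3 ?_
  filter_upwards [h2] with ω hω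
  rw [hω, piKernel_apply]
  have : (fun w => T.indicator (fun _ => (1 : ℝ)) ((fun i => x i ω), w)) =
      {w | ((fun i => x i ω), w) ∈ T}.indicator fun _ => (1 : ℝ) := rfl
  have hm : MeasurableSet {w | ((fun i => x i ω), w) ∈ T} := measurable_prodMk_left hT
  rw [this, integral_indicator_const _ hm]
  simp

/-! ### Moments of the conditional noise laws. -/

/-- The moment conditions on the law of the noise. -/
structure IsNoiseLaw (β σ m : ℝ) (κ : Measure ℝ) : Prop where
  prob : IsProbabilityMeasure κ
  integrable_moment : Integrable (fun t : ℝ => |t| ^ (2 * β)) κ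
  mean : ∫ t, t ∂κ = 0
  variance : ∫ t, t ^ 2 ∂κ = σ ^ 2
  moment : ∫ t, |t| ^ (2 * β) ∂κ = m

lemma sq_le_one_add_rpow {β : ℝ} (hβ : 1 < β) (t : ℝ) : t ^ 2 ≤ 1 + |t| ^ (2 * β) := by
  rcases le_total |t| 1 with h | h
  · have : t ^ 2 ≤ 1 := by rw [← sq_abs]; nlinarith [abs_nonneg t]
    have : 0 ≤ |t| ^ (2 * β) := by positivity
    linarith
  · have : |t| ^ (2 : ℝ) ≤ |t| ^ (2 * β) := Real.rpow_le_rpow_of_exponent_le h (by linarith)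
    rw [Real.rpow_two, sq_abs] at this
    linarith

lemma integrable_sq_of_moment {Ω : Type*} [MeasurableSpace Ω] {μ : Measure Ω} [IsFiniteMeasure μ]
    {β : ℝ} (hβ : 1 < β) {f : Ω → ℝ} (hf : AEStronglyMeasurable f μ)
    (h : Integrable (fun ω => |f ω| ^ (2 * β)) μ) : Integrable (fun ω => f ω ^ 2) μ :=
  ((integrable_const 1).add h).mono' (hf.pow 2) (Filter.Eventually.of_forall fun ω => by
    rw [Real.norm_of_nonneg (sq_nonneg _)]; exact sq_le_one_add_rpow hβ _)

lemma integrable_of_sq {Ω : Type*} [MeasurableSpace Ω] {μ : Measure Ω} [IsFiniteMeasure μ]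
    {f : Ω → ℝ} (hf : AEStronglyMeasurable f μ)
    (h : Integrable (fun ω => f ω ^ 2) μ) : Integrable f μ :=
  ((integrable_const 1).add h).mono' hf (Filter.Eventually.of_forall fun ω => by
    rw [Real.norm_eq_abs, Pi.add_apply, ← sq_abs (f ω)]; nlinarith [sq_nonneg (|f ω| - 1)])

/-- Conditional expectations given xᵢ are integrals against `condDistrib`, so the conditional moment
assumptions become ordinary moments of almost every frozen law. -/
lemma IsLinearModel.isNoiseLaw {Ω : Type*} [MeasurableSpace Ω] {μ : Measure Ω}
    [IsProbabilityMeasure μ] {d n : ℕ} {β σ m : ℝ} (hβ : 1 < β) {θstar : EuclideanSpace ℝ (Fin d)}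
    {x : Fin n → Ω → EuclideanSpace ℝ (Fin d)} {noise y : Fin n → Ω → ℝ}
    (h : IsLinearModel μ β σ m θstar x noise y) :
    ∀ᵐ ω ∂μ, ∀ i, IsNoiseLaw β σ m (condDistrib (noise i) (x i) μ (x i ω)) := by
  rw [ae_all_iff]
  intro i
  have hx := h.measurable_design i
  have hz := h.measurable_noise i
  have hsq := integrable_sq_of_moment hβ hz.aestronglyMeasurable (h.integrable_moment i)
  have hint := integrable_of_sq hz.aestronglyMeasurable hsq
  have e1 := condExp_ae_eq_integral_condDistrib' hx hint
  have e2 := condExp_ae_eq_integral_condDistrib (f := fun t : ℝ => t ^ 2) hx hz.aemeasurable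
    (by fun_prop) hsq
  have hms : Measurable fun t : ℝ => |t| ^ (2 * β) := by fun_prop
  have e3 := condExp_ae_eq_integral_condDistrib (f := fun t : ℝ => |t| ^ (2 * β)) hx hz.aemeasurable
    hms.stronglyMeasurable (h.integrable_moment i)
  have e4 := Integrable.condDistrib_ae (μ := μ) (X := x i) (Y := noise i)
    (f := fun p => |p.2| ^ (2 * β)) hx.aemeasurable hz.aemeasurable
    ((integrable_map_measure (hms.comp measurable_snd).aestronglyMeasurable
      (hx.prodMk hz).aemeasurable).2 (h.integrable_moment i))
  filter_upwards [e1, e2, e3, e4, h.cond_mean i, h.cond_variance i, h.cond_moment i] with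
    ω a1 a2 a3 a4 b1 b2 b3
  exact ⟨inferInstance, a4, by rw [← a1, b1], by rw [← a2, b2], by rw [← a3, b3]⟩

lemma IsLinearModel.indep_noise {Ω : Type*} [MeasurableSpace Ω] {μ : Measure Ω}
    {d n : ℕ} {β σ m : ℝ} {θstar : EuclideanSpace ℝ (Fin d)}
    {x : Fin n → Ω → EuclideanSpace ℝ (Fin d)} {noise y : Fin n → Ω → ℝ}
    (h : IsLinearModel μ β σ m θstar x noise y) :
    iIndepFun (fun i ω => (x i ω, noise i ω)) μ := by
  have := h.indep.comp (fun _ (p : ℝ × EuclideanSpace ℝ (Fin d)) =>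
    (p.2, p.1 - inner ℝ p.2 θstar)) fun i => by fun_prop
  convert this using 2 with i
  ext ω : 1
  simp [h.model i ω]

/-! ### Exponential moment bounds from the Catoni inequalities. -/

/-- Chernoff's bound for a sum of functions of independent coordinates. -/
lemma pi_real_le_exp {ι : Type*} [Fintype ι] (κ : ι → Measure ℝ) [∀ i, IsProbabilityMeasure (κ i)]
    {f g : ι → ℝ → ℝ} {c : ι → ℝ} (hf : ∀ i, Measurable (f i)) (hg : ∀ i, Integrable (g i) (κ i))
    (hfg : ∀ i t, Real.exp (f i t) ≤ g i t) (hc : ∀ i, ∫ t, g i t ∂κ i ≤ Real.exp (c i)) (s : ℝ) :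
    (Measure.pi κ).real {w | s ≤ ∑ i, f i (w i)} ≤ Real.exp (∑ i, c i - s) := by
  have hint : ∀ i, Integrable (fun t => Real.exp (f i t)) (κ i) := fun i =>
    (hg i).mono' (Real.measurable_exp.comp (hf i)).aestronglyMeasurable
      (Filter.Eventually.of_forall fun t => by
        rw [Real.norm_of_nonneg (Real.exp_pos _).le]; exact hfg i t)
  have h1 := mul_meas_ge_le_integral_of_nonneg (μ := Measure.pi κ)
    (f := fun w => ∏ i, Real.exp (f i (w i)))
    (Filter.Eventually.of_forall fun w => Finset.prod_nonneg fun i _ => (Real.exp_pos _).le)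
    (Integrable.fintype_prod hint) (Real.exp s)
  rw [integral_fintype_prod_eq_prod (fun i t => Real.exp (f i t))] at h1
  have h2 : ∏ i, ∫ t, Real.exp (f i t) ∂κ i ≤ Real.exp (∑ i, c i) := by
    rw [Real.exp_sum]
    exact Finset.prod_le_prod (fun i _ => integral_nonneg fun t => (Real.exp_pos _).le)
      fun i _ => (integral_mono (hint i) (hg i) (hfg i)).trans (hc i)
  have h3 : {w : ι → ℝ | s ≤ ∑ i, f i (w i)} =
      {w | Real.exp s ≤ ∏ i, Real.exp (f i (w i))} := by
    ext w
    simp [← Real.exp_sum]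
  rw [h3, Real.exp_sub, le_div_iff₀ (Real.exp_pos _), mul_comm]
  exact h1.trans h2

/-- Bernoulli's inequality for |x|^β bounds the expression below by 1/β + x + |x|. -/
lemma one_add_add_rpow_pos {β : ℝ} (hβ : 1 < β) (x : ℝ) : 0 < 1 + x + |x| ^ β / β := by
  have h := one_add_mul_self_le_rpow_one_add (s := |x| - 1) (by linarith [abs_nonneg x]) hβ.le
  rw [add_sub_cancel] at h
  have h1 : (1 + β * (|x| - 1)) / β ≤ |x| ^ β / β := by gcongr
  have h2 : (1 + β * (|x| - 1)) / β = 1 / β + |x| - 1 := by field_simp; ring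
  have h3 : 0 < 1 / β := by positivity
  linarith [neg_abs_le x]

lemma IsCatoniFunction.exp_le {β : ℝ} (hβ : 1 < β) {ψ : ℝ → ℝ} (h : IsCatoniFunction β ψ) (x : ℝ) :
    Real.exp (ψ x) ≤ 1 + x + |x| ^ β / β :=
  (Real.exp_le_exp.2 (h.upper x)).trans_eq (Real.exp_log (one_add_add_rpow_pos hβ x))

lemma IsCatoniFunction.exp_neg_le {β : ℝ} (hβ : 1 < β) {ψ : ℝ → ℝ} (h : IsCatoniFunction β ψ)
    (x : ℝ) : Real.exp (-ψ x) ≤ 1 - x + |x| ^ β / β := by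
  have hp := one_add_add_rpow_pos hβ (-x)
  rw [abs_neg, ← sub_eq_add_neg] at hp
  exact (Real.exp_le_exp.2 (neg_le.1 (h.lower x))).trans_eq (Real.exp_log hp)

lemma exp_mul_le_of_exp_le {w u A : ℝ} (hw0 : 0 ≤ w) (hw1 : w ≤ 1) (h : Real.exp u ≤ 1 + A) :
    Real.exp (w * u) ≤ 1 + w * A := by
  have hA : -1 ≤ A := by linarith [Real.exp_pos u]
  rw [mul_comm w u, Real.exp_mul]
  exact (Real.rpow_le_rpow (Real.exp_pos _).le h hw0).trans
    (rpow_one_add_le_one_add_mul_self hA hw0 hw1)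

/-- The weights w will be normalized coordinates ±xᵢₖ/B. The sign of w selects the Catoni
inequality, and Bernoulli's inequality with exponent |w| ≤ 1 carries it through the power. -/
lemma IsCatoniFunction.exp_mul_le {ψ : ℝ → ℝ} (h : IsCatoniFunction 2 ψ) {w : ℝ} (hw : |w| ≤ 1)
    (z : ℝ) : Real.exp (w * ψ z) ≤ 1 + w * z + z ^ 2 / 2 := by
  have e : |z| ^ (2 : ℝ) = z ^ 2 := by rw [Real.rpow_two, sq_abs]
  rcases le_total 0 w with h0 | h0
  · rw [abs_of_nonneg h0] at hw
    have := exp_mul_le_of_exp_le (u := ψ z) (A := z + z ^ 2 / 2) h0 hw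
      (by have := h.exp_le one_lt_two z; rw [e] at this; linarith)
    nlinarith [sq_nonneg z]
  · rw [abs_of_nonpos h0] at hw
    have := exp_mul_le_of_exp_le (u := -ψ z) (A := -z + z ^ 2 / 2) (neg_nonneg.2 h0) hw
      (by have := h.exp_neg_le one_lt_two z; rw [e] at this; linarith)
    rw [neg_mul_neg] at this
    nlinarith [sq_nonneg z]

namespace IsNoiseLaw

variable {β σ m : ℝ} {κ : Measure ℝ}

lemma integrable_sq (h : IsNoiseLaw β σ m κ) (hβ : 1 < β) : Integrable (fun t : ℝ => t ^ 2) κ :=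
  have := h.prob
  integrable_sq_of_moment hβ aestronglyMeasurable_id h.integrable_moment

lemma integrable_id (h : IsNoiseLaw β σ m κ) (hβ : 1 < β) : Integrable (fun t : ℝ => t) κ :=
  have := h.prob
  integrable_of_sq aestronglyMeasurable_id (h.integrable_sq hβ)

/-- All integrable majorants below have this shape, so their integrals are exact in terms of σ² and
m. -/
lemma integrable_quadratic (h : IsNoiseLaw β σ m κ) (hβ : 1 < β) (A B C D : ℝ) :
    Integrable (fun t : ℝ => A + B * t + C * t ^ 2 + D * |t| ^ (2 * β)) κ :=
  have := h.prob
  (((integrable_const A).add ((h.integrable_id hβ).const_mul B)).add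
    ((h.integrable_sq hβ).const_mul C)).add (h.integrable_moment.const_mul D)

lemma integral_quadratic (h : IsNoiseLaw β σ m κ) (hβ : 1 < β) (A B C D : ℝ) :
    ∫ t : ℝ, A + B * t + C * t ^ 2 + D * |t| ^ (2 * β) ∂κ = A + C * σ ^ 2 + D * m := by
  have := h.prob
  have i1 := integrable_const (μ := κ) A
  have i2 := (h.integrable_id hβ).const_mul B
  have i3 := (h.integrable_sq hβ).const_mul C
  rw [integral_add (by exact (i1.add i2).add i3) (h.integrable_moment.const_mul D),
    integral_add (by exact i1.add i2) i3, integral_add i1 i2]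
  have h1 : ∫ t, B * t ∂κ = 0 := by rw [integral_const_mul B fun t => t, h.mean, mul_zero]
  simp [integral_const_mul, h1, h.variance, h.moment]

end IsNoiseLaw

/-- Exponential bound for the larger of the two values of `w ψ(b τ (t - s))` at the ends of a short
`τ`-interval. -/
lemma exp_max_trend_le {ψ : ℝ → ℝ} (hψ : IsCatoniFunction 2 ψ) {σ w b τ₁ τ₂ : ℝ} (hσ : 0 < σ)
    (hw : |w| ≤ 1) (hb : 0 ≤ b) (h0 : 0 ≤ τ₁) (h12 : τ₁ ≤ τ₂) (h2 : τ₂ ≤ 2)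
    (hd : τ₂ - τ₁ ≤ b * σ) (R : ℝ) :
    Real.exp (max (w * ψ (b * τ₁ * R)) (w * ψ (b * τ₂ * R))) ≤
      1 + w * b * τ₁ * R + b ^ 2 * (σ ^ 2 / 2 + 5 / 2 * R ^ 2) := by
  have hq : ∀ τ, 0 ≤ τ → τ ≤ 2 → (b * τ * R) ^ 2 / 2 ≤ b ^ 2 * (2 * R ^ 2) := by
    intro τ h0 h2
    have : τ ^ 2 ≤ 4 := by nlinarith
    have h3 : 0 ≤ b ^ 2 * R ^ 2 := by positivity
    nlinarith
  have e1 := hψ.exp_mul_le hw (b * τ₁ * R)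
  have e2 := hψ.exp_mul_le hw (b * τ₂ * R)
  have q1 := hq τ₁ h0 (h12.trans h2)
  have q2 := hq τ₂ (h0.trans h12) h2
  -- The linear term at τ₂ is compared with that at τ₁. The excess is at most b²σ|R|, which AM-GM
  -- moves into the quadratic term.
  have hcross : w * (b * τ₂ * R) ≤ w * b * τ₁ * R + b ^ 2 * (σ ^ 2 / 2 + R ^ 2 / 2) := by
    have h3 : w * R ≤ |R| := (le_abs_self _).trans (by
      rw [abs_mul]; exact mul_le_of_le_one_left (abs_nonneg _) hw)
    have h4 : |R| * σ ≤ (σ ^ 2 + R ^ 2) / 2 := by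
      rw [← sq_abs R]; nlinarith [sq_nonneg (|R| - σ)]
    have h5 : (τ₂ - τ₁) * (w * R) ≤ b * σ * |R| :=
      (mul_le_mul_of_nonneg_left h3 (sub_nonneg.2 h12)).trans
        (mul_le_mul_of_nonneg_right hd (abs_nonneg _))
    have h6 : b * ((τ₂ - τ₁) * (w * R)) ≤ b * (b * σ * |R|) := mul_le_mul_of_nonneg_left h5 hb
    have h7 : b ^ 2 * (|R| * σ) ≤ b ^ 2 * ((σ ^ 2 + R ^ 2) / 2) :=
      mul_le_mul_of_nonneg_left h4 (sq_nonneg b)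
    nlinarith
  rw [Real.exp_monotone.map_max]
  have h8 : 0 ≤ b ^ 2 * (σ ^ 2 / 2 + R ^ 2 / 2) := by positivity
  refine max_le ?_ ?_ <;> nlinarith

/-- The second moment of t - s is σ² + s² ≤ 2σ², so the quadratic part integrates to at most (1/2 +
5)(bσ)², below 6(bσ)². -/
lemma integral_trend_le {β σ m : ℝ} (hβ : 1 < β) {κ : Measure ℝ} (h : IsNoiseLaw β σ m κ)
    {w b τ s : ℝ} (hs : s ^ 2 ≤ σ ^ 2) :
    Integrable (fun t : ℝ =>
        1 + w * b * τ * (t - s) + b ^ 2 * (σ ^ 2 / 2 + 5 / 2 * (t - s) ^ 2)) κ ∧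
      ∫ t : ℝ, 1 + w * b * τ * (t - s) + b ^ 2 * (σ ^ 2 / 2 + 5 / 2 * (t - s) ^ 2) ∂κ ≤
        Real.exp (-(b * τ * (w * s)) + 6 * (b * σ) ^ 2) := by
  have e : (fun t : ℝ =>
        1 + w * b * τ * (t - s) + b ^ 2 * (σ ^ 2 / 2 + 5 / 2 * (t - s) ^ 2)) = fun t =>
      (1 - w * b * τ * s + b ^ 2 * (σ ^ 2 / 2 + 5 / 2 * s ^ 2)) +
        (w * b * τ - 5 * b ^ 2 * s) * t + (5 / 2 * b ^ 2) * t ^ 2 + 0 * |t| ^ (2 * β) := by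
    ext t; ring
  refine ⟨?_, ?_⟩
  · rw [e]; exact h.integrable_quadratic hβ _ _ _ _
  · rw [e, h.integral_quadratic hβ]
    refine le_trans ?_ (Real.add_one_le_exp _)
    have := mul_le_mul_of_nonneg_left hs (sq_nonneg b)
    nlinarith [sq_nonneg (b * σ)]

lemma rpow_scale_le {β u T : ℝ} (hβ₁ : 1 < β) (hβ₂ : β ≤ 2) (hT : 0 ≤ T) (hu : |u| ≤ 4 * T + 5) :
    |u| ^ β ≤ 81 * (T ^ β + 1) := by
  have h0 : 0 ≤ max T 1 := le_max_of_le_left hT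
  have h1 : |u| ≤ 9 * max T 1 := by linarith [le_max_left T 1, le_max_right T 1]
  have h2 : |u| ^ β ≤ (9 * max T 1) ^ β := Real.rpow_le_rpow (abs_nonneg _) h1 (by linarith)
  have h3 : (9 : ℝ) ^ β ≤ 81 :=
    (Real.rpow_le_rpow_of_exponent_le (by norm_num) hβ₂).trans_eq (by norm_num)
  have h4 : (max T 1) ^ β ≤ T ^ β + 1 := by
    rcases max_choice T 1 with h | h <;> rw [h]
    · linarith
    · rw [Real.one_rpow]; linarith [Real.rpow_nonneg hT β]
  rw [Real.mul_rpow (by norm_num) h0] at h2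
  exact h2.trans (mul_le_mul h3 h4 (Real.rpow_nonneg h0 _) (by norm_num))

lemma abs_scale_le {σ r p t : ℝ} (hσ : 0 < σ) (hr0 : 0 ≤ r) (hr : r ≤ σ) (hp0 : 0 ≤ p) (hp : p ≤ 2)
    {z : ℝ} (hz : |z| ≤ (|t| + r) ^ 2) :
    |p * (z / σ ^ 2) - 1| ≤ 4 * (t ^ 2 / σ ^ 2) + 5 := by
  have h1 : (|t| + r) ^ 2 ≤ 2 * (t ^ 2 + σ ^ 2) := by
    rw [← sq_abs t]; nlinarith [sq_nonneg (|t| - r)]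
  have h2 : |z / σ ^ 2| ≤ 2 * (t ^ 2 / σ ^ 2) + 2 := by
    rw [abs_div, abs_of_nonneg (sq_nonneg σ), div_le_iff₀ (by positivity)]
    calc |z| ≤ 2 * (t ^ 2 + σ ^ 2) := hz.trans h1
      _ = _ := by field_simp
  calc |p * (z / σ ^ 2) - 1| ≤ |p * (z / σ ^ 2)| + |1| := abs_sub _ _
    _ = p * |z / σ ^ 2| + 1 := by rw [abs_mul, abs_of_nonneg hp0, abs_one]
    _ ≤ 2 * (2 * (t ^ 2 / σ ^ 2) + 2) + 1 := by gcongr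
    _ = _ := by ring

lemma rpow_abs_mul_div_le {β α u A : ℝ} (hβ : 1 < β) (hα : 0 ≤ α) (h : |u| ^ β ≤ A) :
    |α * u| ^ β / β ≤ α ^ β * A := by
  rw [abs_mul, Real.mul_rpow (abs_nonneg _) (abs_nonneg _), abs_of_nonneg hα]
  have h0 : 0 ≤ α ^ β * |u| ^ β :=
    mul_nonneg (Real.rpow_nonneg hα _) (Real.rpow_nonneg (abs_nonneg _) _)
  exact (div_le_self h0 hβ.le).trans (mul_le_mul_of_nonneg_left h (Real.rpow_nonneg hα _))

lemma sq_div_rpow {β σ t : ℝ} (hσ : 0 < σ) :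
    (t ^ 2 / σ ^ 2) ^ β = (σ ^ (2 * β))⁻¹ * |t| ^ (2 * β) := by
  rw [Real.div_rpow (sq_nonneg _) (sq_nonneg _), ← sq_abs t, ← Real.rpow_natCast_mul (abs_nonneg t),
    ← Real.rpow_natCast_mul hσ.le, div_eq_inv_mul]
  norm_num

/-- The constant in front of `α₂ ^ β` in the exponential bounds for the scale equation. -/
noncomputable def scaleConst (β σ m : ℝ) : ℝ := 81 * ((σ ^ (2 * β))⁻¹ * m + 1)

/-- Replaces |t| in the envelopes by a combination of 1 and t², whose mean is known. -/
lemma abs_mul_le_sq_add {σ t : ℝ} (hσ : 0 < σ) : 2 * |t| ≤ σ + t ^ 2 / σ := by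
  have h : t ^ 2 / σ * σ = t ^ 2 := by field_simp
  rw [← sq_abs t] at *
  nlinarith [sq_nonneg (|t| - σ)]

/-- Exponential bound for the lower envelope of the scale equation. -/
lemma scale_lower_bound {β σ m : ℝ} (hβ₁ : 1 < β) (hβ₂ : β ≤ 2) (hσ : 0 < σ) {κ : Measure ℝ}
    (h : IsNoiseLaw β σ m κ) {ψ : ℝ → ℝ} (hψ : IsCatoniFunction β ψ) {α r p : ℝ} (hα : 0 ≤ α)
    (hr0 : 0 ≤ r) (hr : r ≤ σ) (hp0 : 0 ≤ p) (hp : p ≤ 2) :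
    ∃ g : ℝ → ℝ, Integrable g κ ∧
      (∀ t, Real.exp (-ψ (α * (p * ((t ^ 2 - 2 * r * |t|) / σ ^ 2) - 1))) ≤ g t) ∧
      ∫ t, g t ∂κ ≤
        Real.exp (-(α * (p * (1 - 2 * (r / σ)) - 1)) + α ^ β * scaleConst β σ m) := by
  refine ⟨fun t => (1 + α + α * p * r / σ + 81 * α ^ β) + 0 * t +
    (-(α * p / σ ^ 2 * (1 - r / σ))) * t ^ 2 + (81 * α ^ β * (σ ^ (2 * β))⁻¹) * |t| ^ (2 * β),
    h.integrable_quadratic hβ₁ _ _ _ _, fun t => ?_, ?_⟩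
  · refine (hψ.exp_neg_le hβ₁ _).trans ?_
    have h1 := rpow_abs_mul_div_le hβ₁ hα (rpow_scale_le hβ₁ hβ₂ (T := t ^ 2 / σ ^ 2)
      (by positivity) (abs_scale_le (z := t ^ 2 - 2 * r * |t|) (t := t) hσ hr0 hr hp0 hp (by
        rw [← sq_abs t, abs_le]
        constructor <;> nlinarith [abs_nonneg t, mul_nonneg hr0 (abs_nonneg t), sq_nonneg r])))
    rw [sq_div_rpow hσ] at h1
    have h2 := mul_le_mul_of_nonneg_left (abs_mul_le_sq_add (t := t) hσ) hr0
    have h3 : (t ^ 2 - r * (σ + t ^ 2 / σ)) / σ ^ 2 ≤ (t ^ 2 - 2 * r * |t|) / σ ^ 2 := by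
      gcongr ?_ / _; linarith
    have h4 := mul_le_mul_of_nonneg_left h3 (mul_nonneg hα hp0)
    have h5 : α * p * ((t ^ 2 - r * (σ + t ^ 2 / σ)) / σ ^ 2) =
        -(α * p * r / σ) + (α * p / σ ^ 2 * (1 - r / σ)) * t ^ 2 := by field_simp; ring
    nlinarith
  · rw [h.integral_quadratic hβ₁]
    refine le_trans (le_of_eq ?_) (Real.add_one_le_exp _)
    unfold scaleConst
    have : α * p / σ ^ 2 * (1 - r / σ) * σ ^ 2 = α * p * (1 - r / σ) := by field_simp
    linear_combination -this

/-- Exponential bound for the upper envelope of the scale equation. -/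
lemma scale_upper_bound {β σ m : ℝ} (hβ₁ : 1 < β) (hβ₂ : β ≤ 2) (hσ : 0 < σ) {κ : Measure ℝ}
    (h : IsNoiseLaw β σ m κ) {ψ : ℝ → ℝ} (hψ : IsCatoniFunction β ψ) {α r p : ℝ} (hα : 0 ≤ α)
    (hr0 : 0 ≤ r) (hr : r ≤ σ) (hp0 : 0 ≤ p) (hp : p ≤ 2) :
    ∃ g : ℝ → ℝ, Integrable g κ ∧
      (∀ t, Real.exp (ψ (α * (p * ((|t| + r) ^ 2 / σ ^ 2) - 1))) ≤ g t) ∧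
      ∫ t, g t ∂κ ≤
        Real.exp (α * (p * (1 + r / σ) ^ 2 - 1) + α ^ β * scaleConst β σ m) := by
  refine ⟨fun t => (1 - α + α * p * r / σ + α * p * r ^ 2 / σ ^ 2 + 81 * α ^ β) + 0 * t +
    (α * p / σ ^ 2 * (1 + r / σ)) * t ^ 2 + (81 * α ^ β * (σ ^ (2 * β))⁻¹) * |t| ^ (2 * β),
    h.integrable_quadratic hβ₁ _ _ _ _, fun t => ?_, ?_⟩
  · refine (hψ.exp_le hβ₁ _).trans ?_
    have h1 := rpow_abs_mul_div_le hβ₁ hα (rpow_scale_le hβ₁ hβ₂ (T := t ^ 2 / σ ^ 2)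
      (by positivity) (abs_scale_le (z := (|t| + r) ^ 2) (t := t) hσ hr0 hr hp0 hp (by
        rw [abs_of_nonneg (sq_nonneg _)])))
    rw [sq_div_rpow hσ] at h1
    have h2 := mul_le_mul_of_nonneg_left (abs_mul_le_sq_add (t := t) hσ) hr0
    have h3 : (|t| + r) ^ 2 / σ ^ 2 ≤ (t ^ 2 + r * (σ + t ^ 2 / σ) + r ^ 2) / σ ^ 2 := by
      gcongr ?_ / _; rw [← sq_abs t] at *; linarith
    have h4 := mul_le_mul_of_nonneg_left h3 (mul_nonneg hα hp0)
    have h5 : α * p * ((t ^ 2 + r * (σ + t ^ 2 / σ) + r ^ 2) / σ ^ 2) =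
        α * p * r / σ + α * p * r ^ 2 / σ ^ 2 + (α * p / σ ^ 2 * (1 + r / σ)) * t ^ 2 := by
      field_simp; ring
    nlinarith
  · rw [h.integral_quadratic hβ₁]
    refine le_trans (le_of_eq ?_) (Real.add_one_le_exp _)
    unfold scaleConst
    have : α * p / σ ^ 2 * (1 + r / σ) * σ ^ 2 = α * p * (1 + r / σ) := by field_simp
    linear_combination this

/-! ### Convexity and existence of a common zero. -/

section Existence

variable {E : Type*} [NormedAddCommGroup E] [InnerProductSpace ℝ E]

/-- A local minimum of a convex function with continuous (negative) gradient `G` is a zero of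
`G`. -/
lemma eq_zero_of_isLocalMin_of_subgradient {F : E → ℝ} {G : E → E} (hG : Continuous G)
    (hsub : ∀ p h, F p - inner ℝ (G p) (h - p) ≤ F h) {h : E} (hmin : IsLocalMin F h) :
    G h = 0 := by
  have hc : Continuous fun t : ℝ => h + t • G h := by fun_prop
  have hc0 : Filter.Tendsto (fun t : ℝ => h + t • G h) (nhdsWithin 0 (Set.Ioi 0)) (nhds h) := by
    have := hc.tendsto 0
    rw [zero_smul, add_zero] at this
    exact this.mono_left nhdsWithin_le_nhds
  have hlim : Filter.Tendsto (fun t : ℝ => inner ℝ (G (h + t • G h)) (G h))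
      (nhdsWithin 0 (Set.Ioi 0)) (nhds (inner ℝ (G h) (G h))) :=
    ((hG.tendsto h).comp hc0).inner tendsto_const_nhds
  -- Along h + tG(h), local minimality and the subgradient inequality at the moved point give ⟨G(h +
  -- tG(h)), G(h)⟩ ≤ 0; then t tends to 0.
  have hle : inner ℝ (G h) (G h) ≤ 0 := by
    refine le_of_tendsto hlim ?_
    filter_upwards [hc0.eventually hmin, self_mem_nhdsWithin] with t ht htpos
    have h1 := hsub (h + t • G h) h
    rw [sub_add_cancel_left, inner_neg_right, real_inner_smul_right] at h1
    have h2 : t * inner ℝ (G (h + t • G h)) (G h) ≤ 0 := by linarith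
    exact nonpos_of_mul_nonpos_right h2 htpos
  exact inner_self_eq_zero.1 (le_antisymm hle real_inner_self_nonneg)

lemma isMinOn_of_subgradient_zero {F : E → ℝ} {G : E → E}
    (hsub : ∀ p h, F p - inner ℝ (G p) (h - p) ≤ F h) {p : E} (hp : G p = 0) (h : E) :
    F p ≤ F h := by
  have := hsub p h
  rwa [hp, inner_zero_left, sub_zero] at this

/-- The zeros of G are exactly the minimizers of the convex function F. -/
lemma convex_zeros_of_subgradient {F : E → ℝ} {G : E → E} (hG : Continuous G)
    (hsub : ∀ p h, F p - inner ℝ (G p) (h - p) ≤ F h) : Convex ℝ {h | G h = 0} := by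
  intro p hp q hq a b ha hb hab
  refine eq_zero_of_isLocalMin_of_subgradient hG hsub (Filter.Eventually.of_forall fun h => ?_)
  set z := a • p + b • q with hz
  have h1 := mul_le_mul_of_nonneg_left
    ((hsub z p).trans (isMinOn_of_subgradient_zero hsub hp h)) ha
  have h2 := mul_le_mul_of_nonneg_left
    ((hsub z q).trans (isMinOn_of_subgradient_zero hsub hq h)) hb
  have h3 : a * inner ℝ (G z) (p - z) + b * inner ℝ (G z) (q - z) = 0 := by
    rw [← real_inner_smul_right, ← real_inner_smul_right, ← inner_add_right]
    have : a • (p - z) + b • (q - z) = 0 := by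
      rw [smul_sub, smul_sub, sub_add_sub_comm, ← add_smul, hab, one_smul, ← hz, sub_self]
    rw [this, inner_zero_right]
  have h4 : a * F z + b * F z = F z := by rw [← add_mul, hab, one_mul]
  have h5 : a * F h + b * F h = F h := by rw [← add_mul, hab, one_mul]
  linarith

/-- A minimizer over the ball cannot lie on the sphere: the given p would have F p < F h. -/
lemma exists_zero_of_subgradient [FiniteDimensional ℝ E] {F : E → ℝ} {G : E → E} {ρ : ℝ}
    (hρ : 0 ≤ ρ) (hF : Continuous F) (hG : Continuous G)
    (hsub : ∀ p h, F p - inner ℝ (G p) (h - p) ≤ F h)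
    (hsphere : ∀ h, ‖h‖ = ρ → ∃ p, ‖p‖ ≤ ρ ∧ inner ℝ (G p) (h - p) < 0) :
    ∃ h, ‖h‖ ≤ ρ ∧ G h = 0 := by
  obtain ⟨h, hh, hmin⟩ := (isCompact_closedBall (0 : E) ρ).exists_isMinOn
    ⟨0, by simpa using hρ⟩ hF.continuousOn
  rw [mem_closedBall_zero_iff] at hh
  refine ⟨h, hh, eq_zero_of_isLocalMin_of_subgradient hG hsub (hmin.isLocalMin ?_)⟩
  rcases hh.lt_or_eq with hlt | heq
  · exact Filter.mem_of_superset (Metric.isOpen_ball.mem_nhds (mem_ball_zero_iff.2 hlt))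
      Metric.ball_subset_closedBall
  · obtain ⟨p, hp, hneg⟩ := hsphere h heq
    have h1 : F h ≤ F p := hmin (mem_closedBall_zero_iff.2 hp)
    linarith [hsub p h]

/-- Two coupled equations `G τ h = 0`, `s τ h = 0`, where `-G τ` is the gradient of a convex
function and `s` changes its sign between the endpoints of the `τ`-interval, have a solution. -/
lemma exists_coupled_zero [FiniteDimensional ℝ E] {F : ℝ → E → ℝ} {G : ℝ → E → E}
    {s : ℝ → E → ℝ} {ρ τ₀ τ₁ : ℝ} (hρ : 0 ≤ ρ) (hτ : τ₀ ≤ τ₁) (hF : ∀ τ, Continuous (F τ))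
    (hG : Continuous fun p : ℝ × E => G p.1 p.2) (hs : Continuous fun p : ℝ × E => s p.1 p.2)
    (hsub : ∀ τ ∈ Set.Icc τ₀ τ₁, ∀ p h, F τ p - inner ℝ (G τ p) (h - p) ≤ F τ h)
    (hsphere : ∀ τ ∈ Set.Icc τ₀ τ₁, ∀ h, ‖h‖ = ρ → ∃ p, ‖p‖ ≤ ρ ∧ inner ℝ (G τ p) (h - p) < 0)
    (hs₀ : ∀ h, ‖h‖ ≤ ρ → s τ₀ h ≤ 0) (hs₁ : ∀ h, ‖h‖ ≤ ρ → 0 ≤ s τ₁ h) :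
    ∃ τ ∈ Set.Icc τ₀ τ₁, ∃ h, ‖h‖ ≤ ρ ∧ G τ h = 0 ∧ s τ h = 0 := by
  have hGτ : ∀ τ, Continuous (G τ) := fun τ => hG.comp (by fun_prop : Continuous fun h => (τ, h))
  have hsτ : ∀ τ, Continuous (s τ) := fun τ => hs.comp (by fun_prop : Continuous fun h => (τ, h))
  have hne : ∀ τ ∈ Set.Icc τ₀ τ₁, ∃ h, ‖h‖ ≤ ρ ∧ G τ h = 0 := fun τ hτ =>
    exists_zero_of_subgradient hρ (hF τ) (hGτ τ) (hsub τ hτ) (hsphere τ hτ)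
  set K : Set (ℝ × E) := (Set.Icc τ₀ τ₁ ×ˢ Metric.closedBall 0 ρ) ∩ {p | G p.1 p.2 = 0} with hK
  have hKc : IsCompact K := (isCompact_Icc.prod (isCompact_closedBall _ _)).inter_right
    (isClosed_eq hG continuous_const)
  have hA : IsClosed (Prod.fst '' (K ∩ {p | s p.1 p.2 ≤ 0})) :=
    ((hKc.inter_right (isClosed_le hs continuous_const)).image continuous_fst).isClosed
  have hB : IsClosed (Prod.fst '' (K ∩ {p | 0 ≤ s p.1 p.2})) :=
    ((hKc.inter_right (isClosed_le continuous_const hs)).image continuous_fst).isClosed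
  have hmem : ∀ τ ∈ Set.Icc τ₀ τ₁, ∀ h, ‖h‖ ≤ ρ → G τ h = 0 → (τ, h) ∈ K := fun τ hτ h hh h0 =>
    ⟨⟨hτ, mem_closedBall_zero_iff.2 hh⟩, h0⟩
  have hl := Set.left_mem_Icc.2 hτ
  have hr := Set.right_mem_Icc.2 hτ
  obtain ⟨h₀, hh₀, e₀⟩ := hne τ₀ hl
  obtain ⟨h₁, hh₁, e₁⟩ := hne τ₁ hr
  -- The values of τ having a root with s ≤ 0 and those having one with s ≥ 0 form two nonempty
  -- closed sets covering the interval, so they meet. At a common τ both signs occur in one convex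
  -- fibre, where the intermediate value theorem applies.
  obtain ⟨τ, hτI, ⟨⟨τ', p⟩, ⟨hpK, hp⟩, rfl⟩, ⟨⟨τ'', q⟩, ⟨hqK, hq⟩, heq⟩⟩ :=
    isPreconnected_closed_iff.1 (isPreconnected_Icc (a := τ₀) (b := τ₁)) _ _ hA hB
      (fun τ hτI => by
        obtain ⟨h, hh, h0⟩ := hne τ hτI
        rcases le_total (s τ h) 0 with hle | hle
        · exact Or.inl ⟨(τ, h), ⟨hmem τ hτI h hh h0, hle⟩, rfl⟩
        · exact Or.inr ⟨(τ, h), ⟨hmem τ hτI h hh h0, hle⟩, rfl⟩)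
      ⟨τ₀, hl, (τ₀, h₀), ⟨hmem τ₀ hl h₀ hh₀ e₀, hs₀ h₀ hh₀⟩, rfl⟩
      ⟨τ₁, hr, (τ₁, h₁), ⟨hmem τ₁ hr h₁ hh₁ e₁, hs₁ h₁ hh₁⟩, rfl⟩
  simp only at heq
  subst heq
  have hfib : Convex ℝ (Metric.closedBall (0 : E) ρ ∩ {h | G τ'' h = 0}) :=
    (convex_closedBall 0 ρ).inter (convex_zeros_of_subgradient (hGτ τ'') (hsub τ'' hτI))
  obtain ⟨h, ⟨hh, h0⟩, hsh⟩ := hfib.isPreconnected.intermediate_value₂ (f := s τ'')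
    (g := fun _ => 0) ⟨hpK.1.2, hpK.2⟩ ⟨hqK.1.2, hqK.2⟩ (hsτ τ'').continuousOn
    continuousOn_const hp hq
  exact ⟨τ'', hτI, h, mem_closedBall_zero_iff.1 hh, h0, hsh⟩

end Existence

/-- The primitive of a monotone function lies above its tangents. -/
lemma tangent_le_primitive {ψ : ℝ → ℝ} (hc : Continuous ψ) (hm : Monotone ψ) (s t : ℝ) :
    (∫ u in (0 : ℝ)..s, ψ u) + ψ s * (t - s) ≤ ∫ u in (0 : ℝ)..t, ψ u := by
  have hi : ∀ a b, IntervalIntegrable ψ volume a b := fun a b => hc.intervalIntegrable a b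
  have h1 := intervalIntegral.integral_add_adjacent_intervals (hi 0 s) (hi s t)
  have h2 : ψ s * (t - s) ≤ ∫ u in s..t, ψ u := by
    rcases le_total s t with h | h
    · have := intervalIntegral.integral_mono_on h (intervalIntegrable_const (c := ψ s)) (hi s t)
        fun u hu => hm hu.1
      rw [intervalIntegral.integral_const, smul_eq_mul] at this
      linarith
    · have := intervalIntegral.integral_mono_on h (hi t s) (intervalIntegrable_const (c := ψ s))
        fun u hu => hm hu.2
      rw [intervalIntegral.integral_const, smul_eq_mul] at this
      rw [intervalIntegral.integral_symm]
      linarith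
  linarith

/-- Existence of a solution of the coupled equations, in terms of `τ = σ / v` and
`h = θ - θstar`. -/
lemma exists_coupled_solution {d n : ℕ} {ψ₁ ψ₂ : ℝ → ℝ} (hc₁ : Continuous ψ₁) (hm₁ : Monotone ψ₁)
    (hc₂ : Continuous ψ₂) {b α σ ρ τ₀ τ₁ : ℝ} (hb : 0 < b) (hρ : 0 ≤ ρ) (hτ₀ : 0 < τ₀)
    (hτ : τ₀ ≤ τ₁) (x : Fin n → EuclideanSpace ℝ (Fin d)) (z : Fin n → ℝ)
    (hsphere : ∀ τ ∈ Set.Icc τ₀ τ₁, ∀ h : EuclideanSpace ℝ (Fin d), ‖h‖ = ρ → ∃ p, ‖p‖ ≤ ρ ∧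
      inner ℝ (∑ i, ψ₁ (b * τ * (z i - inner ℝ (x i) p)) • x i) (h - p) < 0)
    (hs₀ : ∀ h : EuclideanSpace ℝ (Fin d), ‖h‖ ≤ ρ →
      ∑ i, ψ₂ (α * (τ₀ ^ 2 * ((z i - inner ℝ (x i) h) ^ 2 / σ ^ 2) - 1)) ≤ 0)
    (hs₁ : ∀ h : EuclideanSpace ℝ (Fin d), ‖h‖ ≤ ρ →
      0 ≤ ∑ i, ψ₂ (α * (τ₁ ^ 2 * ((z i - inner ℝ (x i) h) ^ 2 / σ ^ 2) - 1))) :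
    ∃ τ ∈ Set.Icc τ₀ τ₁, ∃ h : EuclideanSpace ℝ (Fin d), ‖h‖ ≤ ρ ∧
      ∑ i, ψ₁ (b * τ * (z i - inner ℝ (x i) h)) • x i = 0 ∧
      ∑ i, ψ₂ (α * (τ ^ 2 * ((z i - inner ℝ (x i) h) ^ 2 / σ ^ 2) - 1)) = 0 := by
  have hprim : Continuous fun t : ℝ => ∫ u in (0 : ℝ)..t, ψ₁ u :=
    intervalIntegral.continuous_primitive (fun a b => hc₁.intervalIntegrable a b) 0
  -- The factor (bτ)⁻¹ cancels the one produced by the chain rule, so that -G is the gradient of F.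
  refine exists_coupled_zero
    (F := fun τ h => (b * τ)⁻¹ * ∑ i, ∫ u in (0 : ℝ)..(b * τ * (z i - inner ℝ (x i) h)), ψ₁ u)
    (G := fun τ h => ∑ i, ψ₁ (b * τ * (z i - inner ℝ (x i) h)) • x i)
    (s := fun τ h => ∑ i, ψ₂ (α * (τ ^ 2 * ((z i - inner ℝ (x i) h) ^ 2 / σ ^ 2) - 1)))
    hρ hτ (fun τ => ?_) ?_ ?_ ?_ hsphere hs₀ hs₁
  · exact continuous_const.mul (continuous_finsetSum _ fun i _ => hprim.comp (by fun_prop))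
  · exact continuous_finsetSum _ fun i _ => (hc₁.comp (by fun_prop)).smul continuous_const
  · exact continuous_finsetSum _ fun i _ => hc₂.comp (by fun_prop)
  · intro τ hτI p h
    have hpos : 0 < b * τ := mul_pos hb (hτ₀.trans_le hτI.1)
    have hτ0 : τ ≠ 0 := (hτ₀.trans_le hτI.1).ne'
    have key : (b * τ)⁻¹ * ∑ i, ((∫ u in (0 : ℝ)..(b * τ * (z i - inner ℝ (x i) p)), ψ₁ u) +
        ψ₁ (b * τ * (z i - inner ℝ (x i) p)) *
          (b * τ * (z i - inner ℝ (x i) h) - b * τ * (z i - inner ℝ (x i) p))) ≤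
        (b * τ)⁻¹ * ∑ i, ∫ u in (0 : ℝ)..(b * τ * (z i - inner ℝ (x i) h)), ψ₁ u :=
      mul_le_mul_of_nonneg_left (Finset.sum_le_sum fun i _ => tangent_le_primitive hc₁ hm₁ _ _)
        (inv_pos.2 hpos).le
    refine le_trans (le_of_eq ?_) key
    rw [Finset.sum_add_distrib, mul_add, sub_eq_add_neg]
    congr 1
    rw [sum_inner, Finset.mul_sum, ← Finset.sum_neg_distrib]
    refine Finset.sum_congr rfl fun i _ => ?_
    rw [real_inner_smul_left, inner_sub_right]
    field_simp
    ring

/-! ### Deterministic step: from finitely many inequalities to a solution. -/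

/-- The sums `∑ ⟨xᵢ, u⟩²` dominate `n c ‖u‖²`, and the design vectors are bounded by `B`. -/
structure IsSpreadDesign {d n : ℕ} (c B : ℝ) (x : Fin n → EuclideanSpace ℝ (Fin d)) : Prop where
  sum_sq_ge : ∀ u, n * c * ‖u‖ ^ 2 ≤ ∑ i, inner ℝ (x i) u ^ 2
  norm_le : ∀ i, ‖x i‖ ≤ B

/-- The sum over the samples of the larger of the values of `wᵢ ψ(b t (zᵢ - sᵢ))` at `t = τ, τ'`. -/
noncomputable def trendMax {n : ℕ} (ψ : ℝ → ℝ) (b τ τ' : ℝ) (w s z : Fin n → ℝ) : ℝ :=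
  ∑ i, max (w i * ψ (b * τ * (z i - s i))) (w i * ψ (b * τ' * (z i - s i)))

/-- Lower envelope of the scale equation over parameters with `|⟨xᵢ, h⟩| ≤ r`. -/
noncomputable def scaleLower {n : ℕ} (ψ : ℝ → ℝ) (α σ r p : ℝ) (z : Fin n → ℝ) : ℝ :=
  ∑ i, ψ (α * (p * ((z i ^ 2 - 2 * r * |z i|) / σ ^ 2) - 1))

/-- Upper envelope of the scale equation over parameters with `|⟨xᵢ, h⟩| ≤ r`. -/
noncomputable def scaleUpper {n : ℕ} (ψ : ℝ → ℝ) (α σ r p : ℝ) (z : Fin n → ℝ) : ℝ :=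
  ∑ i, ψ (α * (p * ((|z i| + r) ^ 2 / σ ^ 2) - 1))

/-- For fixed signs of w and R the left side is monotone in τ, so the ends of a cell control its
interior. -/
lemma mul_map_le_max {ψ : ℝ → ℝ} (hψ : Monotone ψ) {b τ₁ τ τ₂ : ℝ} (hb : 0 ≤ b) (h1 : τ₁ ≤ τ)
    (h2 : τ ≤ τ₂) (w R : ℝ) :
    w * ψ (b * τ * R) ≤ max (w * ψ (b * τ₁ * R)) (w * ψ (b * τ₂ * R)) := by
  have e1 : b * τ₁ ≤ b * τ := mul_le_mul_of_nonneg_left h1 hb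
  have e2 : b * τ ≤ b * τ₂ := mul_le_mul_of_nonneg_left h2 hb
  rcases le_total 0 w with hw | hw <;> rcases le_total 0 R with hR | hR
  · exact le_max_of_le_right (mul_le_mul_of_nonneg_left
      (hψ (mul_le_mul_of_nonneg_right e2 hR)) hw)
  · exact le_max_of_le_left (mul_le_mul_of_nonneg_left
      (hψ (mul_le_mul_of_nonpos_right e1 hR)) hw)
  · exact le_max_of_le_left (mul_le_mul_of_nonpos_left
      (hψ (mul_le_mul_of_nonneg_right e1 hR)) hw)
  · exact le_max_of_le_right (mul_le_mul_of_nonpos_left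
      (hψ (mul_le_mul_of_nonpos_right e2 hR)) hw)

/-- A point of `[τ₀, τ₀ + M a)` lies in one of the `M` cells of length `a`. -/
lemma exists_cell {τ₀ τ a : ℝ} {M : ℕ} (ha : 0 < a) (h0 : τ₀ ≤ τ) (h1 : τ < τ₀ + M * a) :
    ∃ l < M, τ₀ + l * a ≤ τ ∧ τ ≤ τ₀ + (l + 1 : ℕ) * a := by
  have hnn : 0 ≤ (τ - τ₀) / a := div_nonneg (sub_nonneg.2 h0) ha.le
  refine ⟨⌊(τ - τ₀) / a⌋₊, ?_, ?_, ?_⟩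
  · rw [Nat.floor_lt hnn, div_lt_iff₀ ha]; linarith
  · have := Nat.floor_le hnn
    rw [le_div_iff₀ ha] at this; linarith
  · have := Nat.lt_floor_add_one ((τ - τ₀) / a)
    rw [div_lt_iff₀ ha] at this; push_cast; linarith

/-- The signs `1` and `-1`. -/
def sgn (e : Bool) : ℝ := cond e 1 (-1)

lemma abs_sgn (e : Bool) : |sgn e| = 1 := by cases e <;> simp [sgn]

lemma abs_coord_div_le {d n : ℕ} {c B : ℝ} (hB : 0 < B) {x : Fin n → EuclideanSpace ℝ (Fin d)}
    (hx : IsSpreadDesign c B x) (e : Bool) (k : Fin d) (i : Fin n) : |sgn e * x i k / B| ≤ 1 := by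
  rw [abs_div, abs_mul, abs_sgn, one_mul, abs_of_pos hB, div_le_one hB]
  exact (PiLp.norm_apply_le (x i) k).trans (hx.norm_le i)

lemma abs_inner_le {d n : ℕ} {c B ρ : ℝ} {x : Fin n → EuclideanSpace ℝ (Fin d)}
    (hx : IsSpreadDesign c B x) {h : EuclideanSpace ℝ (Fin d)} (hh : ‖h‖ ≤ ρ) (i : Fin n) :
    |inner ℝ (x i) h| ≤ B * ρ :=
  (abs_real_inner_le_norm _ _).trans (mul_le_mul (hx.norm_le i) hh (norm_nonneg _)
    ((norm_nonneg _).trans (hx.norm_le i)))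

/-- The crude factor d costs only a constant, because d will be bounded. -/
lemma inner_le_of_abs_coord_le {d : ℕ} {V y : EuclideanSpace ℝ (Fin d)} {A : ℝ}
    (hV : ∀ k, |V k| ≤ A) (hA : 0 ≤ A) : inner ℝ V y ≤ A * (d * ‖y‖) := by
  rw [PiLp.inner_apply]
  calc ∑ k, inner ℝ (V k) (y k) ≤ ∑ _k : Fin d, A * ‖y‖ := Finset.sum_le_sum fun k _ =>
        (real_inner_le_norm _ _).trans (mul_le_mul (hV k) (PiLp.norm_apply_le y k)
          (norm_nonneg _) hA)
    _ = A * (d * ‖y‖) := by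
      rw [Finset.sum_const, Finset.card_univ, Fintype.card_fin, nsmul_eq_mul]; ring

/-- The trend function at the net points is close to its linearization. -/
lemma abs_trend_coord_le {d n : ℕ} {ψ : ℝ → ℝ} (hm : Monotone ψ) {c B a b σ ρ t K η τ : ℝ}
    (hB : 0 < B) (ha : 0 < a) (hb : 0 ≤ b) (hba : b * σ = a) {M : ℕ} (hBρ : B * ρ ≤ σ)
    {x : Fin n → EuclideanSpace ℝ (Fin d)} (hx : IsSpreadDesign c B x) {z : Fin n → ℝ}
    {p : EuclideanSpace ℝ (Fin d)} (hp : ‖p‖ ≤ ρ)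
    (htrend : ∀ (k : Fin d) (e : Bool) (l : ℕ), l < M →
      trendMax ψ b (1 - η + l * a) (1 - η + (l + 1 : ℕ) * a) (fun i => sgn e * x i k / B)
          (fun i => inner ℝ (x i) p) z ≤
        ∑ i, (-(b * (1 - η + l * a) * (sgn e * x i k / B * inner ℝ (x i) p)) + 6 * a ^ 2) + t)
    (ht : t ≤ K * n * a ^ 2) (hτ₀ : 1 - η ≤ τ) (hτ₁ : τ < 1 - η + M * a) (k : Fin d) :
    |(∑ i, (ψ (b * τ * (z i - inner ℝ (x i) p)) + b * τ * inner ℝ (x i) p) • x i) k| ≤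
      B * ((K + 7) * n * a ^ 2) := by
  obtain ⟨l, hl, hl1, hl2⟩ := exists_cell ha hτ₀ hτ₁
  have key : ∀ e : Bool, sgn e *
      (∑ i, (ψ (b * τ * (z i - inner ℝ (x i) p)) + b * τ * inner ℝ (x i) p) • x i) k ≤
        B * ((K + 7) * n * a ^ 2) := by
    intro e
    have h1 : ∑ i, (sgn e * x i k / B * (ψ (b * τ * (z i - inner ℝ (x i) p)) +
        b * τ * inner ℝ (x i) p)) ≤ (K + 7) * n * a ^ 2 := by
      -- Moving the linear term from τ to the left end of its cell costs at most b·a·σ = a² per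
      -- sample. Together with the 6a² of `htrend` this makes the 7.
      have h2 : ∑ i, (sgn e * x i k / B * (ψ (b * τ * (z i - inner ℝ (x i) p)) +
          b * τ * inner ℝ (x i) p)) ≤
          trendMax ψ b (1 - η + l * a) (1 - η + (l + 1 : ℕ) * a) (fun i => sgn e * x i k / B)
          (fun i => inner ℝ (x i) p) z +
            ∑ i, ((b * (1 - η + l * a) * (sgn e * x i k / B * inner ℝ (x i) p)) + a ^ 2) := by
        rw [trendMax, ← Finset.sum_add_distrib]
        refine Finset.sum_le_sum fun i _ => ?_
        have h3 := mul_map_le_max hm hb hl1 hl2 (sgn e * x i k / B) (z i - inner ℝ (x i) p)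
        set w := sgn e * x i k / B with hw
        set s := inner ℝ (x i) p with hs
        have hw1 : |w| ≤ 1 := abs_coord_div_le hB hx e k i
        have hs1 : |s| ≤ σ := (abs_inner_le hx hp i).trans hBρ
        have h4 : w * s ≤ σ := (le_abs_self _).trans (by
          rw [abs_mul]; exact (mul_le_of_le_one_left (abs_nonneg s) hw1).trans hs1)
        have hσ : 0 ≤ σ := (abs_nonneg s).trans hs1
        have h5 : (τ - (1 - η + l * a)) * (w * s) ≤ a * σ :=
          (mul_le_mul_of_nonneg_left h4 (sub_nonneg.2 hl1)).trans
            (mul_le_mul_of_nonneg_right (by push_cast at hl2; linarith) hσ)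
        have h6 := mul_le_mul_of_nonneg_left h5 hb
        have h7 : b * (a * σ) = a ^ 2 := by rw [← hba]; ring
        linarith
      have h8 := htrend k e l hl
      rw [Finset.sum_add_distrib, Finset.sum_neg_distrib, Finset.sum_const, Finset.card_univ,
        Fintype.card_fin, nsmul_eq_mul] at h8
      rw [Finset.sum_add_distrib, Finset.sum_const, Finset.card_univ,
        Fintype.card_fin, nsmul_eq_mul] at h2
      linarith
    have h9 : sgn e * (∑ i, (ψ (b * τ * (z i - inner ℝ (x i) p)) +
        b * τ * inner ℝ (x i) p) • x i) k =
        B * ∑ i, (sgn e * x i k / B * (ψ (b * τ * (z i - inner ℝ (x i) p)) +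
        b * τ * inner ℝ (x i) p)) := by
      rw [WithLp.ofLp_sum, Finset.sum_apply, Finset.mul_sum, Finset.mul_sum]
      refine Finset.sum_congr rfl fun i _ => ?_
      simp only [PiLp.smul_apply, smul_eq_mul]
      field_simp
    rw [h9]
    exact mul_le_mul_of_nonneg_left h1 hB.le
  have hp := key true
  have hn := key false
  simp only [sgn, cond_true, cond_false] at hp hn
  rw [abs_le]
  constructor <;> linarith

/-- The quadratic form of the design is positive between a point of the sphere and a point close to
its half. -/
lemma sum_inner_mul_inner_ge {d n : ℕ} {c B ρ : ℝ} {x : Fin n → EuclideanSpace ℝ (Fin d)}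
    (hx : IsSpreadDesign c B x) {h p : EuclideanSpace ℝ (Fin d)} (hh : ‖h‖ = ρ)
    (hp : B ^ 2 * ‖p - (1 / 2 : ℝ) • h‖ ^ 2 ≤ c * ρ ^ 2 / 9) (hc : 0 ≤ c) :
    n * c * ρ ^ 2 / 8 ≤ ∑ i, inner ℝ (x i) p * inner ℝ (x i) (h - p) := by
  -- With p = h/2 + e each product is ⟨xᵢ, h⟩²/4 - ⟨xᵢ, e⟩², and 1/4 - 1/9 ≥ 1/8.
  set e := p - (1 / 2 : ℝ) • h with he
  have h1 : ∀ i, inner ℝ (x i) p * inner ℝ (x i) (h - p) =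
      inner ℝ (x i) h ^ 2 / 4 - inner ℝ (x i) e ^ 2 := by
    intro i
    rw [he, inner_sub_right, inner_sub_right, real_inner_smul_right]; ring
  have h2 : ∀ i, inner ℝ (x i) e ^ 2 ≤ c * ρ ^ 2 / 9 := by
    intro i
    refine le_trans ?_ hp
    rw [← sq_abs, ← mul_pow]
    exact pow_le_pow_left₀ (abs_nonneg _) (abs_inner_le hx le_rfl i) 2
  have h3 := hx.sum_sq_ge h
  have h4 : ∑ i, inner ℝ (x i) e ^ 2 ≤ n * (c * ρ ^ 2 / 9) := by
    refine (Finset.sum_le_sum fun i _ => h2 i).trans_eq ?_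
    rw [Finset.sum_const, Finset.card_univ, Fintype.card_fin, nsmul_eq_mul]
  simp only [h1]
  rw [Finset.sum_sub_distrib, ← Finset.sum_div]
  rw [hh] at h3
  have : 0 ≤ (n : ℝ) * c * ρ ^ 2 := by positivity
  nlinarith

/-- On the event described by the hypotheses, the coupled equations have a solution. -/
lemma exists_solution_of_event {d n : ℕ} {ψ₁ ψ₂ : ℝ → ℝ} (hc₁ : Continuous ψ₁) (hm₁ : Monotone ψ₁)
    (hc₂ : Continuous ψ₂) (hm₂ : Monotone ψ₂) {c B a α σ ρ t K η : ℝ} (hn : 0 < n) (hc : 0 < c)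
    (hB : 0 < B) (hσ : 0 < σ) (ha : 0 < a) (hα : 0 ≤ α) (hρ : 0 < ρ) (hBρ : B * ρ ≤ σ)
    (hη₀ : 0 ≤ η) (hη : η ≤ 1 / 2) (hK : 0 ≤ K) (hρK : 32 * B * (K + 7) * d * σ * a < c * ρ)
    {M : ℕ} (hM : 2 * η < M * a) {P : Finset (EuclideanSpace ℝ (Fin d))}
    (hP : ∀ p ∈ P, ‖p‖ ≤ 1)
    (hnet : ∀ u : EuclideanSpace ℝ (Fin d), ‖u‖ = 1 → ∃ p ∈ P,
      B ^ 2 * ‖p - (1 / 2 : ℝ) • u‖ ^ 2 ≤ c / 9)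
    {x : Fin n → EuclideanSpace ℝ (Fin d)} (hx : IsSpreadDesign c B x) {z : Fin n → ℝ}
    (htrend : ∀ p ∈ P, ∀ (k : Fin d) (e : Bool) (l : ℕ), l < M →
      trendMax ψ₁ (a / σ) (1 - η + l * a) (1 - η + (l + 1 : ℕ) * a) (fun i => sgn e * x i k / B)
          (fun i => inner ℝ (x i) (ρ • p)) z ≤
        ∑ i, (-(a / σ * (1 - η + l * a) * (sgn e * x i k / B * inner ℝ (x i) (ρ • p))) +
          6 * a ^ 2) + t)
    (ht : t ≤ K * n * a ^ 2)
    (hlower : 0 ≤ scaleLower ψ₂ α σ (B * ρ) (1 + η) z)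
    (hupper : scaleUpper ψ₂ α σ (B * ρ) (1 - η) z ≤ 0) :
    ∃ τ ∈ Set.Icc (√(1 - η)) (√(1 + η)), ∃ h : EuclideanSpace ℝ (Fin d), ‖h‖ ≤ ρ ∧
      ∑ i, ψ₁ (a / σ * τ * (z i - inner ℝ (x i) h)) • x i = 0 ∧
      ∑ i, ψ₂ (α * (τ ^ 2 * ((z i - inner ℝ (x i) h) ^ 2 / σ ^ 2) - 1)) = 0 := by
  have hb : 0 < a / σ := div_pos ha hσ
  have hba : a / σ * σ = a := div_mul_cancel₀ a hσ.ne'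
  have h1η : 0 < 1 - η := by linarith
  have hsq₀ : √(1 - η) ^ 2 = 1 - η := Real.sq_sqrt h1η.le
  have hsq₁ : √(1 + η) ^ 2 = 1 + η := Real.sq_sqrt (by linarith)
  -- Both square roots lie in [1 - η, 1 + η], which the M cells starting at 1 - η cover.
  have hge : 1 - η ≤ √(1 - η) := Real.le_sqrt_of_sq_le (by nlinarith)
  have hle : √(1 + η) ≤ 1 + η := by
    rw [Real.sqrt_le_left (by linarith)]; nlinarith
  refine exists_coupled_solution hc₁ hm₁ hc₂ hb hρ.le (Real.sqrt_pos.2 h1η)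
    (Real.sqrt_le_sqrt (by linarith)) x z ?_ ?_ ?_
  · intro τ hτ h hh
    have hτ₀ : 1 - η ≤ τ := hge.trans hτ.1
    have hτ₁ : τ < 1 - η + M * a := by have := hτ.2; linarith
    obtain ⟨q, hqP, hq⟩ := hnet (ρ⁻¹ • h) (by
      rw [norm_smul, hh, norm_inv, Real.norm_of_nonneg hρ.le, inv_mul_cancel₀ hρ.ne'])
    have hqn : ‖ρ • q‖ ≤ ρ := by
      rw [norm_smul, Real.norm_of_nonneg hρ.le]
      exact mul_le_of_le_one_right hρ.le (hP q hqP)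
    refine ⟨ρ • q, hqn, ?_⟩
    have hclose : B ^ 2 * ‖ρ • q - (1 / 2 : ℝ) • h‖ ^ 2 ≤ c * ρ ^ 2 / 9 := by
      have e1 : ρ • q - (1 / 2 : ℝ) • h = ρ • (q - (1 / 2 : ℝ) • ρ⁻¹ • h) := by
        rw [smul_sub, smul_comm ρ (1 / 2 : ℝ), smul_inv_smul₀ hρ.ne']
      rw [e1, norm_smul, Real.norm_of_nonneg hρ.le, mul_pow]
      nlinarith [mul_le_mul_of_nonneg_left hq (sq_nonneg ρ)]
    have h1 := sum_inner_mul_inner_ge hx hh hclose hc.le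
    have h2 := inner_le_of_abs_coord_le (y := h - ρ • q)
      (abs_trend_coord_le hm₁ hB ha hb.le hba hBρ hx hqn (htrend q hqP) ht hτ₀ hτ₁)
      (by positivity)
    have h3 : ‖h - ρ • q‖ ≤ 2 * ρ := (norm_sub_le _ _).trans (by linarith)
    -- The linear part contributes at least (a/σ) n c ρ²/16 since τ ≥ 1/2; by `hρK` this exceeds the
    -- linearization error, so the trend term itself is negative.
    have h4 : inner ℝ (∑ i, (ψ₁ (a / σ * τ * (z i - inner ℝ (x i) (ρ • q))) +
        a / σ * τ * inner ℝ (x i) (ρ • q)) • x i) (h - ρ • q) =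
        inner ℝ (∑ i, ψ₁ (a / σ * τ * (z i - inner ℝ (x i) (ρ • q))) • x i) (h - ρ • q) +
        a / σ * τ * ∑ i, inner ℝ (x i) (ρ • q) * inner ℝ (x i) (h - ρ • q) := by
      simp only [sum_inner, real_inner_smul_left, Finset.mul_sum, ← Finset.sum_add_distrib]
      exact Finset.sum_congr rfl fun i _ => by ring
    rw [h4] at h2
    have hn' : (0 : ℝ) < n := Nat.cast_pos.2 hn
    have h5 : a / σ * (1 / 2) * (n * c * ρ ^ 2 / 8) ≤
        a / σ * τ * ∑ i, inner ℝ (x i) (ρ • q) * inner ℝ (x i) (h - ρ • q) :=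
      mul_le_mul (mul_le_mul_of_nonneg_left (by linarith) hb.le) h1 (by positivity)
        (mul_nonneg hb.le (by linarith))
    have h6 : B * ((K + 7) * n * a ^ 2) * (d * ‖h - ρ • q‖) ≤
        B * ((K + 7) * n * a ^ 2) * (d * (2 * ρ)) := by gcongr
    have h7 : B * ((K + 7) * n * a ^ 2) * (d * (2 * ρ)) <
        a / σ * (1 / 2) * (n * c * ρ ^ 2 / 8) := by
      have := mul_lt_mul_of_pos_left hρK (by positivity : 0 < a / σ * n * ρ / 16)
      have e : a / σ * n * ρ / 16 * (32 * B * (K + 7) * d * σ * a) =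
          B * ((K + 7) * n * a ^ 2) * (d * (2 * ρ)) := by field_simp; ring
      rw [e] at this
      linarith
    linarith
  · intro h hh
    refine le_trans (Finset.sum_le_sum fun i _ => hm₂ ?_) hupper
    rw [hsq₀]
    have h1 := abs_inner_le hx hh i
    have h2 : (z i - inner ℝ (x i) h) ^ 2 ≤ (|z i| + B * ρ) ^ 2 := by
      rw [← sq_abs]
      exact pow_le_pow_left₀ (abs_nonneg _) ((abs_sub _ _).trans (by linarith)) 2
    gcongr
  · intro h hh
    refine le_trans hlower (Finset.sum_le_sum fun i _ => hm₂ ?_)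
    rw [hsq₁]
    have h1 := abs_inner_le hx hh i
    have h2 : z i ^ 2 - 2 * (B * ρ) * |z i| ≤ (z i - inner ℝ (x i) h) ^ 2 := by
      have h3 : z i * inner ℝ (x i) h ≤ |z i| * (B * ρ) := (le_abs_self _).trans (by
        rw [abs_mul]; exact mul_le_mul_of_nonneg_left h1 (abs_nonneg _))
      nlinarith [sq_nonneg (inner ℝ (x i) h)]
    gcongr

/-- The event, in the space of designs and noise vectors, on which the coupled equations are shown
to have a solution. -/
def solutionEvent {d n : ℕ} (ψ₁ ψ₂ : ℝ → ℝ) (c B a α σ ρ t η : ℝ) (M : ℕ)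
    (P : Finset (EuclideanSpace ℝ (Fin d))) :
    Set ((Fin n → EuclideanSpace ℝ (Fin d)) × (Fin n → ℝ)) :=
  {q | IsSpreadDesign c B q.1 ∧
    (∀ p ∈ P, ∀ (k : Fin d) (e : Bool) (l : ℕ), l < M →
      trendMax ψ₁ (a / σ) (1 - η + l * a) (1 - η + (l + 1 : ℕ) * a) (fun i => sgn e * q.1 i k / B)
          (fun i => inner ℝ (q.1 i) (ρ • p)) q.2 ≤
        ∑ i, (-(a / σ * (1 - η + l * a) * (sgn e * q.1 i k / B * inner ℝ (q.1 i) (ρ • p))) +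
          6 * a ^ 2) + t) ∧
    0 ≤ scaleLower ψ₂ α σ (B * ρ) (1 + η) q.2 ∧ scaleUpper ψ₂ α σ (B * ρ) (1 - η) q.2 ≤ 0}

/-- The intersection over u is uncountable, but each condition is closed in x. -/
lemma measurableSet_isSpreadDesign {d n : ℕ} (c B : ℝ) :
    MeasurableSet {x : Fin n → EuclideanSpace ℝ (Fin d) | IsSpreadDesign c B x} := by
  have e : {x : Fin n → EuclideanSpace ℝ (Fin d) | IsSpreadDesign c B x} =
      (⋂ u : EuclideanSpace ℝ (Fin d), {x | n * c * ‖u‖ ^ 2 ≤ ∑ i, inner ℝ (x i) u ^ 2}) ∩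
        ⋂ i, {x | ‖x i‖ ≤ B} := by
    ext x
    simp only [Set.mem_inter_iff, Set.mem_iInter, Set.mem_ofPred_eq]
    exact ⟨fun h => ⟨h.1, h.2⟩, fun h => ⟨h.1, h.2⟩⟩
  rw [e]
  refine IsClosed.measurableSet (IsClosed.inter (isClosed_iInter fun u => ?_)
    (isClosed_iInter fun i => ?_))
  · exact isClosed_le continuous_const (continuous_finsetSum _ fun i _ => by fun_prop)
  · exact isClosed_le (by fun_prop) continuous_const

lemma measurable_trendMax {d n : ℕ} {ψ : ℝ → ℝ} (hψ : Continuous ψ) (b τ τ' B : ℝ) (e : Bool)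
    (k : Fin d) (p : EuclideanSpace ℝ (Fin d)) :
    Measurable fun q : (Fin n → EuclideanSpace ℝ (Fin d)) × (Fin n → ℝ) =>
      trendMax ψ b τ τ' (fun i => sgn e * q.1 i k / B) (fun i => inner ℝ (q.1 i) p) q.2 := by
  have hψ' := hψ.measurable
  unfold trendMax
  fun_prop

lemma measurableSet_solutionEvent {d n : ℕ} {ψ₁ ψ₂ : ℝ → ℝ} (h₁ : Continuous ψ₁)
    (h₂ : Continuous ψ₂) (c B a α σ ρ t η : ℝ) (M : ℕ) (P : Finset (EuclideanSpace ℝ (Fin d))) :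
    MeasurableSet (solutionEvent (n := n) ψ₁ ψ₂ c B a α σ ρ t η M P) := by
  have hψ := h₂.measurable
  have e : solutionEvent (n := n) ψ₁ ψ₂ c B a α σ ρ t η M P =
      (Prod.fst ⁻¹' {x | IsSpreadDesign c B x} ∩
        ⋂ p ∈ P, ⋂ k : Fin d, ⋂ e : Bool, ⋂ l : ℕ, ⋂ _ : l < M,
          {q : (Fin n → EuclideanSpace ℝ (Fin d)) × (Fin n → ℝ) |
            trendMax ψ₁ (a / σ) (1 - η + l * a) (1 - η + (l + 1 : ℕ) * a)
                (fun i => sgn e * q.1 i k / B) (fun i => inner ℝ (q.1 i) (ρ • p)) q.2 ≤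
              ∑ i, (-(a / σ * (1 - η + l * a) *
                (sgn e * q.1 i k / B * inner ℝ (q.1 i) (ρ • p))) + 6 * a ^ 2) + t}) ∩
      ({q | 0 ≤ scaleLower ψ₂ α σ (B * ρ) (1 + η) q.2} ∩
        {q | scaleUpper ψ₂ α σ (B * ρ) (1 - η) q.2 ≤ 0}) := by
    ext q
    simp only [solutionEvent, Set.mem_inter_iff, Set.mem_iInter, Set.mem_ofPred_eq,
      Set.mem_preimage, and_assoc]
  rw [e]
  refine MeasurableSet.inter (MeasurableSet.inter
    (measurable_fst (measurableSet_isSpreadDesign c B)) ?_) (MeasurableSet.inter ?_ ?_)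
  · exact P.measurableSet_biInter fun p _ => MeasurableSet.iInter fun k =>
      MeasurableSet.iInter fun e => MeasurableSet.iInter fun l => MeasurableSet.iInter fun _ =>
      measurableSet_le (measurable_trendMax h₁ _ _ _ B e k _) (by fun_prop)
  · exact measurableSet_le measurable_const (by unfold scaleLower; fun_prop)
  · exact measurableSet_le (by unfold scaleUpper; fun_prop) measurable_const

/-! ### Failure probabilities for a frozen design. -/

section Probability

variable {n : ℕ} {β σ m : ℝ} {κ : Fin n → Measure ℝ} [∀ i, IsProbabilityMeasure (κ i)]

lemma real_trend_failure_le (hβ : 1 < β) (hσ : 0 < σ) (hκ : ∀ i, IsNoiseLaw β σ m (κ i))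
    {ψ : ℝ → ℝ} (hψ : IsCatoniFunction 2 ψ) {a τ₁ τ₂ : ℝ} (ha : 0 ≤ a) {w s : Fin n → ℝ}
    (hw : ∀ i, |w i| ≤ 1) (hs : ∀ i, |s i| ≤ σ) (h0 : 0 ≤ τ₁) (h12 : τ₁ ≤ τ₂) (h2 : τ₂ ≤ 2)
    (hd : τ₂ - τ₁ ≤ a) (t : ℝ) :
    (Measure.pi κ).real {z | ∑ i, (-(a / σ * τ₁ * (w i * s i)) + 6 * a ^ 2) + t ≤
      trendMax ψ (a / σ) τ₁ τ₂ w s z} ≤ Real.exp (-t) := by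
  have hba : a / σ * σ = a := div_mul_cancel₀ a hσ.ne'
  have hb : 0 ≤ a / σ := div_nonneg ha hσ.le
  have hm := hψ.continuous.measurable
  have hi := fun i => integral_trend_le hβ (hκ i) (w := w i) (b := a / σ) (τ := τ₁) (s := s i)
    (sq_le_sq' (neg_le_of_abs_le (hs i)) (le_of_abs_le (hs i)))
  have := pi_real_le_exp κ
    (f := fun i u => max (w i * ψ (a / σ * τ₁ * (u - s i))) (w i * ψ (a / σ * τ₂ * (u - s i))))
    (c := fun i => -(a / σ * τ₁ * (w i * s i)) + 6 * a ^ 2) (fun i => by fun_prop)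
    (fun i => (hi i).1)
    (fun i u => exp_max_trend_le hψ hσ (hw i) hb h0 h12 h2 (by rwa [hba]) (u - s i))
    (fun i => by have := (hi i).2; rwa [hba] at this)
    (∑ i, (-(a / σ * τ₁ * (w i * s i)) + 6 * a ^ 2) + t)
  rwa [sub_add_cancel_left] at this

/-- The mean margin (1 + η)(1 - 2r/σ) - 1 is at least η - 4r/σ, and `hl` says that it pays for the
moment term and still leaves l per sample. -/
lemma real_scaleLower_failure_le (hβ₁ : 1 < β) (hβ₂ : β ≤ 2) (hσ : 0 < σ)
    (hκ : ∀ i, IsNoiseLaw β σ m (κ i)) {ψ : ℝ → ℝ} (hψ : IsCatoniFunction β ψ) {α r η l : ℝ}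
    (hα : 0 ≤ α) (hr0 : 0 ≤ r) (hr : r ≤ σ) (hη₀ : 0 ≤ η) (hη : η ≤ 1 / 2)
    (hl : l + α ^ β * scaleConst β σ m ≤ α * (η - 4 * (r / σ))) :
    (Measure.pi κ).real {z | scaleLower ψ α σ r (1 + η) z ≤ 0} ≤ Real.exp (-(n * l)) := by
  have hm := hψ.continuous.measurable
  choose g hg1 hg2 hg3 using fun i => scale_lower_bound hβ₁ hβ₂ hσ (hκ i) hψ hα hr0 hr
    (by linarith : 0 ≤ 1 + η) (by linarith)
  have h := pi_real_le_exp κ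
    (f := fun i t => -ψ (α * ((1 + η) * ((t ^ 2 - 2 * r * |t|) / σ ^ 2) - 1)))
    (fun i => by fun_prop) hg1 hg2 hg3 0
  have e : {z : Fin n → ℝ | scaleLower ψ α σ r (1 + η) z ≤ 0} =
      {z | 0 ≤ ∑ i, -ψ (α * ((1 + η) * ((z i ^ 2 - 2 * r * |z i|) / σ ^ 2) - 1))} := by
    ext z
    rw [Set.mem_ofPred_eq, Set.mem_ofPred_eq, Finset.sum_neg_distrib, neg_nonneg]
    rfl
  rw [e]
  refine h.trans (Real.exp_le_exp.2 ?_)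
  rw [Finset.sum_const, Finset.card_univ, Fintype.card_fin, nsmul_eq_mul, sub_zero, neg_mul_eq_mul_neg (n : ℝ) l]
  refine mul_le_mul_of_nonneg_left ?_ (Nat.cast_nonneg n)
  have hq : 0 ≤ r / σ := by positivity
  have h1 : η - 4 * (r / σ) ≤ (1 + η) * (1 - 2 * (r / σ)) - 1 := by nlinarith
  linarith [mul_le_mul_of_nonneg_left h1 hα]

lemma real_scaleUpper_failure_le (hβ₁ : 1 < β) (hβ₂ : β ≤ 2) (hσ : 0 < σ)
    (hκ : ∀ i, IsNoiseLaw β σ m (κ i)) {ψ : ℝ → ℝ} (hψ : IsCatoniFunction β ψ) {α r η l : ℝ}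
    (hα : 0 ≤ α) (hr0 : 0 ≤ r) (hr : r ≤ σ) (hη₀ : 0 ≤ η) (hη : η ≤ 1 / 2)
    (hl : l + α ^ β * scaleConst β σ m ≤ α * (η - 4 * (r / σ))) :
    (Measure.pi κ).real {z | 0 ≤ scaleUpper ψ α σ r (1 - η) z} ≤ Real.exp (-(n * l)) := by
  have hm := hψ.continuous.measurable
  choose g hg1 hg2 hg3 using fun i => scale_upper_bound hβ₁ hβ₂ hσ (hκ i) hψ hα hr0 hr
    (by linarith : 0 ≤ 1 - η) (by linarith)
  have h := pi_real_le_exp κ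
    (f := fun i t => ψ (α * ((1 - η) * ((|t| + r) ^ 2 / σ ^ 2) - 1)))
    (fun i => by fun_prop) hg1 hg2 hg3 0
  refine h.trans (Real.exp_le_exp.2 ?_)
  rw [Finset.sum_const, Finset.card_univ, Fintype.card_fin, nsmul_eq_mul, sub_zero, neg_mul_eq_mul_neg (n : ℝ) l]
  refine mul_le_mul_of_nonneg_left ?_ (Nat.cast_nonneg n)
  have hq : 0 ≤ r / σ := by positivity
  have hq1 : r / σ ≤ 1 := (div_le_one hσ).2 hr
  have h1 : (1 - η) * (1 + r / σ) ^ 2 - 1 ≤ -(η - 4 * (r / σ)) := by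
    have h2 : 0 ≤ η * (2 * (r / σ) + (r / σ) ^ 2) := by positivity
    nlinarith
  linarith [mul_le_mul_of_nonneg_left h1 hα]

/-- For a frozen design, the complement of the event has probability at most `3ε`. -/
lemma real_compl_solutionEvent_le {d : ℕ} (hβ₁ : 1 < β) (hβ₂ : β ≤ 2) (hσ : 0 < σ)
    (hκ : ∀ i, IsNoiseLaw β σ m (κ i)) {ψ₁ ψ₂ : ℝ → ℝ} (hψ₁ : IsCatoniFunction 2 ψ₁)
    (hψ₂ : IsCatoniFunction β ψ₂) {c B a α ρ t η l ε : ℝ} {M : ℕ}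
    {P : Finset (EuclideanSpace ℝ (Fin d))} (hB : 0 < B) (ha : 0 ≤ a) (hα : 0 ≤ α) (hρ : 0 ≤ ρ)
    (hBρ : B * ρ ≤ σ) (hη₀ : 0 ≤ η) (hη : η ≤ 1 / 2) (hM : 1 - η + M * a ≤ 2)
    (hP : ∀ p ∈ P, ‖p‖ ≤ 1) (hcard : P.card * (d * 2 * M) * Real.exp (-t) ≤ ε)
    (hl : l + α ^ β * scaleConst β σ m ≤ α * (η - 4 * (B * ρ / σ)))
    (hlε : Real.exp (-(n * l)) ≤ ε)
    {x : Fin n → EuclideanSpace ℝ (Fin d)} (hx : IsSpreadDesign c B x) :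
    (Measure.pi κ).real {z | (x, z) ∈ solutionEvent ψ₁ ψ₂ c B a α σ ρ t η M P}ᶜ ≤ 3 * ε := by
  set S : EuclideanSpace ℝ (Fin d) × Fin d × Bool × Fin M → Set (Fin n → ℝ) := fun j =>
    {z | ∑ i, (-(a / σ * (1 - η + (j.2.2.2 : ℕ) * a) *
        (sgn j.2.2.1 * x i j.2.1 / B * inner ℝ (x i) (ρ • j.1))) + 6 * a ^ 2) + t ≤
      trendMax ψ₁ (a / σ) (1 - η + (j.2.2.2 : ℕ) * a) (1 - η + ((j.2.2.2 : ℕ) + 1 : ℕ) * a)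
        (fun i => sgn j.2.2.1 * x i j.2.1 / B) (fun i => inner ℝ (x i) (ρ • j.1)) z} with hS
  have hsub : {z | (x, z) ∈ solutionEvent ψ₁ ψ₂ c B a α σ ρ t η M P}ᶜ ⊆
      (⋃ j ∈ P ×ˢ (Finset.univ : Finset (Fin d × Bool × Fin M)), S j) ∪
      ({z | scaleLower ψ₂ α σ (B * ρ) (1 + η) z ≤ 0} ∪
        {z | 0 ≤ scaleUpper ψ₂ α σ (B * ρ) (1 - η) z}) := by
    intro z hz
    by_contra hcon
    simp only [Set.mem_union, Set.mem_iUnion, not_or, not_exists, Set.mem_ofPred_eq, not_le] at hcon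
    refine hz ⟨hx, fun p hp k e l hl => ?_, hcon.2.1.le, hcon.2.2.le⟩
    have := hcon.1 (p, k, e, ⟨l, hl⟩) (by simp [hp])
    simp only [hS, Set.mem_ofPred_eq, not_le] at this
    exact this.le
  have hSj : ∀ j ∈ P ×ˢ (Finset.univ : Finset (Fin d × Bool × Fin M)),
      (Measure.pi κ).real (S j) ≤ Real.exp (-t) := by
    rintro ⟨p, k, e, l⟩ hj
    have hp : p ∈ P := (Finset.mem_product.1 hj).1
    have hρp : ‖ρ • p‖ ≤ ρ := by
      rw [norm_smul, Real.norm_of_nonneg hρ]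
      exact mul_le_of_le_one_right hρ (hP p hp)
    have hlM : ((l : ℕ) : ℝ) + 1 ≤ M := by exact_mod_cast l.2
    have hla : 0 ≤ ((l : ℕ) : ℝ) * a := by positivity
    have hlMa := mul_le_mul_of_nonneg_right hlM ha
    exact real_trend_failure_le hβ₁ hσ hκ hψ₁ ha (abs_coord_div_le hB hx e k)
      (fun i => (abs_inner_le hx hρp i).trans hBρ) (by linarith) (by push_cast; linarith)
      (by push_cast; linarith) (by push_cast; linarith) t
  have h1 : (Measure.pi κ).real
      (⋃ j ∈ P ×ˢ (Finset.univ : Finset (Fin d × Bool × Fin M)), S j) ≤ ε := by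
    refine (measureReal_biUnion_finset_le _ _).trans ((Finset.sum_le_sum hSj).trans ?_)
    rw [Finset.sum_const, nsmul_eq_mul, Finset.card_product]
    simpa [mul_assoc] using hcard
  have h2 := (real_scaleLower_failure_le hβ₁ hβ₂ hσ hκ hψ₂ hα (by positivity) hBρ hη₀ hη hl).trans
    hlε
  have h3 := (real_scaleUpper_failure_le hβ₁ hβ₂ hσ hκ hψ₂ hα (by positivity) hBρ hη₀ hη hl).trans
    hlε
  have h4 := measureReal_mono (μ := Measure.pi κ) hsub
  have h5 := measureReal_union_le (μ := Measure.pi κ)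
    (⋃ j ∈ P ×ˢ (Finset.univ : Finset (Fin d × Bool × Fin M)), S j)
    ({z | scaleLower ψ₂ α σ (B * ρ) (1 + η) z ≤ 0} ∪
        {z | 0 ≤ scaleUpper ψ₂ α σ (B * ρ) (1 - η) z})
  have h6 := measureReal_union_le (μ := Measure.pi κ)
    {z | scaleLower ψ₂ α σ (B * ρ) (1 + η) z ≤ 0} {z | 0 ≤ scaleUpper ψ₂ α σ (B * ρ) (1 - η) z}
  linarith

end Probability

/-! ### Consequences of a good design. -/

section Design

variable {d n : ℕ}

lemma gramMatrix_quadratic (x : Fin n → EuclideanSpace ℝ (Fin d)) (u : EuclideanSpace ℝ (Fin d)) :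
    (fun k => u k) ⬝ᵥ (gramMatrix x).mulVec (fun k => u k) =
      1 / (n : ℝ) * ∑ i, inner ℝ (x i) u ^ 2 := by
  rw [gramMatrix, Matrix.smul_mulVec, dotProduct_smul, smul_eq_mul, Matrix.sum_mulVec,
    dotProduct_sum]
  congr 1
  refine Finset.sum_congr rfl fun i _ => ?_
  rw [Matrix.vecMulVec_mulVec]
  have e : (inner ℝ (x i) u : ℝ) = (fun k => u k) ⬝ᵥ fun k => x i k := by
    rw [PiLp.inner_apply]
    simp [dotProduct]
  rw [e, sq]
  simp [dotProduct_comm]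

lemma gramMatrix_isHermitian (x : Fin n → EuclideanSpace ℝ (Fin d)) :
    (gramMatrix x).IsHermitian := by
  unfold gramMatrix Matrix.IsHermitian
  rw [Matrix.conjTranspose_eq_transpose_of_trivial]
  ext i j
  simp [Matrix.sum_apply, Matrix.vecMulVec_apply, mul_comm]

/-- Subtracting c_l shifts the spectrum to nonnegative values, so the shifted Gram matrix is
positive semidefinite. -/
lemma IsGoodDesign.isSpreadDesign {c_l c_u L B : ℝ} (hn : 0 < n) (hLB : L ≤ B)
    {x : Fin n → EuclideanSpace ℝ (Fin d)} (h : IsGoodDesign c_l c_u L x) :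
    IsSpreadDesign c_l B x := by
  refine ⟨fun u => ?_, fun i => (h.norm_le i).trans hLB⟩
  have hps : (gramMatrix x - algebraMap ℝ (Matrix (Fin d) (Fin d) ℝ) c_l).PosSemidef := by
    have hH : (gramMatrix x - algebraMap ℝ (Matrix (Fin d) (Fin d) ℝ) c_l).IsHermitian :=
      (gramMatrix_isHermitian x).sub (by
        rw [Algebra.algebraMap_eq_smul_one, Matrix.IsHermitian, Matrix.conjTranspose_smul]
        simp)
    rw [hH.posSemidef_iff_eigenvalues_nonneg]
    intro k
    have h1 := hH.eigenvalues_mem_spectrum_real k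
    rw [← spectrum.sub_singleton_eq] at h1
    obtain ⟨a, ha, b, hb, hab⟩ := h1
    rw [Set.mem_singleton_iff.1 hb] at hab
    have := (h.eigenvalues_mem ha).1
    simp only [Pi.zero_apply]
    linarith
  have h2 := hps.dotProduct_mulVec_nonneg (fun k => u k)
  have h3 : (star fun k => u k) = fun k => u k := by ext; simp
  have hn' : (0 : ℝ) < n := Nat.cast_pos.2 hn
  rw [h3, Matrix.sub_mulVec, dotProduct_sub, gramMatrix_quadratic, Algebra.algebraMap_eq_smul_one,
    Matrix.smul_mulVec, Matrix.one_mulVec, dotProduct_smul, smul_eq_mul] at h2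
  have h4 : (fun k => u k) ⬝ᵥ (fun k => u k) = ‖u‖ ^ 2 := by
    rw [EuclideanSpace.real_norm_sq_eq]
    simp [dotProduct, sq]
  rw [h4] at h2
  have h5 := mul_le_mul_of_nonneg_left (sub_nonneg.1 h2) hn'.le
  have h6 : (n : ℝ) * (1 / n * ∑ i, inner ℝ (x i) u ^ 2) = ∑ i, inner ℝ (x i) u ^ 2 := by
    field_simp
  rw [h6] at h5
  linarith

/-- A trace argument: sum the quadratic-form bound over the standard basis and compare with ∑ ‖xᵢ‖².
This bounds the dimension. -/
lemma IsSpreadDesign.dim_mul_le {c B : ℝ} (hn : 0 < n) {x : Fin n → EuclideanSpace ℝ (Fin d)}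
    (h : IsSpreadDesign c B x) : d * c ≤ B ^ 2 := by
  have hn' : (0 : ℝ) < n := Nat.cast_pos.2 hn
  have h1 : ∀ k : Fin d, n * c ≤ ∑ i, x i k ^ 2 := by
    intro k
    have := h.sum_sq_ge (EuclideanSpace.single k 1)
    simpa [EuclideanSpace.inner_single_right] using this
  have h2 : ∑ _k : Fin d, n * c ≤ ∑ i, ∑ k, x i k ^ 2 := by
    rw [Finset.sum_comm]; exact Finset.sum_le_sum fun k _ => h1 k
  have h3 : ∀ i, ∑ k, x i k ^ 2 ≤ B ^ 2 := by
    intro i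
    rw [← EuclideanSpace.real_norm_sq_eq]
    exact pow_le_pow_left₀ (norm_nonneg _) (h.norm_le i) 2
  have h4 := h2.trans (Finset.sum_le_sum fun i _ => h3 i)
  rw [Finset.sum_const, Finset.sum_const, Finset.card_univ, Finset.card_univ, Fintype.card_fin,
    Fintype.card_fin, nsmul_eq_mul, nsmul_eq_mul] at h4
  have h5 : (n : ℝ) * (d * c) ≤ n * B ^ 2 := by linarith
  exact le_of_mul_le_mul_left h5 hn'

end Design

/-! ### The net and a self-referential inequality. -/

/-- A finite set of points of the unit ball that approximates the halves of all unit vectors. -/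
lemma exists_half_net (d : ℕ) {c B : ℝ} (hc : 0 < c) (hB : 0 < B) :
    ∃ P : Finset (EuclideanSpace ℝ (Fin d)), (∀ p ∈ P, ‖p‖ ≤ 1) ∧
      ∀ u : EuclideanSpace ℝ (Fin d), ‖u‖ = 1 → ∃ p ∈ P,
        B ^ 2 * ‖p - (1 / 2 : ℝ) • u‖ ^ 2 ≤ c / 9 := by
  have he : 0 < √c / (3 * B) := by positivity
  obtain ⟨t, hts, hfin, hcov⟩ := (isCompact_closedBall
    (0 : EuclideanSpace ℝ (Fin d)) 1).finite_cover_balls he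
  refine ⟨hfin.toFinset, fun p hp => ?_, fun u hu => ?_⟩
  · exact mem_closedBall_zero_iff.1 (hts (hfin.mem_toFinset.1 hp))
  · have hu' : (1 / 2 : ℝ) • u ∈ Metric.closedBall (0 : EuclideanSpace ℝ (Fin d)) 1 := by
      rw [mem_closedBall_zero_iff, norm_smul, hu]; norm_num
    obtain ⟨p, hp, hup⟩ := Set.mem_iUnion₂.1 (hcov hu')
    refine ⟨p, hfin.mem_toFinset.2 hp, ?_⟩
    rw [Metric.mem_ball, dist_eq_norm, norm_sub_rev] at hup
    have h1 := pow_le_pow_left₀ (norm_nonneg _) hup.le 2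
    calc B ^ 2 * ‖p - (1 / 2 : ℝ) • u‖ ^ 2 ≤ B ^ 2 * (√c / (3 * B)) ^ 2 := by gcongr
      _ = c / 9 := by rw [div_pow, Real.sq_sqrt hc.le]; field_simp; norm_num

/-- An inequality of the form `A₀ + A₁ log (q₀ + q₁ C) ≤ C` is solvable. -/
lemma exists_add_mul_log_le {A₀ A₁ q₀ q₁ : ℝ} (hA₁ : 0 < A₁) (hq₀ : 0 < q₀) (hq₁ : 0 < q₁) :
    ∃ C : ℝ, 0 < C ∧ A₀ + A₁ * Real.log (q₀ + q₁ * C) ≤ C := by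
  -- Bounding log y by y/k + log k with this k makes the term linear in C exactly C/2.
  set k := 2 * A₁ * q₁ with hk
  have hk0 : 0 < k := by positivity
  set Z := A₀ + A₁ * q₀ / k + A₁ * Real.log k with hZ
  set C := 2 * |Z| + 1 with hC
  have hC0 : 0 < C := by positivity
  refine ⟨C, hC0, ?_⟩
  have hy : 0 < q₀ + q₁ * C := by positivity
  have h1 : Real.log (q₀ + q₁ * C) ≤ (q₀ + q₁ * C) / k + Real.log k := by
    have := Real.log_le_sub_one_of_pos (div_pos hy hk0)
    rw [Real.log_div hy.ne' hk0.ne'] at this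
    linarith
  have h2 := mul_le_mul_of_nonneg_left h1 hA₁.le
  have h3 : A₁ * ((q₀ + q₁ * C) / k + Real.log k) = A₁ * q₀ / k + A₁ * Real.log k + C / 2 := by
    rw [hk]; field_simp; ring
  have h4 := le_abs_self Z
  linarith

/-! ### Sizes of α₁ and α₂. -/

section Rates

variable {β ε : ℝ} {d n : ℕ}

lemma one_lt_log_inv (h0 : 0 < ε) (h1 : ε < 1 / 6) : 1 < Real.log ε⁻¹ := by
  rw [Real.lt_log_iff_exp_lt (inv_pos.2 h0)]
  have h6 : (6 : ℝ) < ε⁻¹ := by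
    rw [lt_inv_comm₀ (by norm_num) h0]; linarith
  linarith [Real.exp_one_lt_d9]

lemma scaleRate_eq (hε₀ : 0 < ε) (hε : ε < 1 / 6) :
    scaleRate β d n ε =
      √((d : ℝ) * Real.log ((d : ℝ) * (n : ℝ) ^ (1 / β - 1 / 2) * ε⁻¹) / (n : ℝ)) +
        (Real.log ε⁻¹ / (n : ℝ)) ^ ((β - 1) / β) := by
  have h1 := one_lt_log_inv hε₀ hε
  rw [scaleRate, alpha₁, alpha₂, ← Real.sqrt_mul (Nat.cast_nonneg d), mul_div_assoc,
    ← Real.rpow_mul (div_nonneg (by linarith) (Nat.cast_nonneg n))]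
  congr 2
  ring

lemma exponent_mem (hβ₁ : 1 < β) (hβ₂ : β ≤ 2) : 0 ≤ 1 / β - 1 / 2 ∧ 1 / β - 1 / 2 ≤ 1 / 2 := by
  have h1 : 1 / 2 ≤ 1 / β := one_div_le_one_div_of_le (by linarith) hβ₂
  have h2 : 1 / β ≤ 1 := by rw [div_le_one (by linarith)]; linarith
  constructor <;> linarith

/-- `log (d n^{1/β - 1/2} ε⁻¹)` as a sum of logarithms. -/
lemma log_rate_eq (hd : 1 ≤ d) (hn : 1 ≤ n) (hε₀ : 0 < ε) :
    Real.log ((d : ℝ) * (n : ℝ) ^ (1 / β - 1 / 2) * ε⁻¹) =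
      Real.log d + (1 / β - 1 / 2) * Real.log n + Real.log ε⁻¹ := by
  have hd' : (0 : ℝ) < d := Nat.cast_pos.2 hd
  have hn' : (0 : ℝ) < n := Nat.cast_pos.2 hn
  rw [Real.log_mul (by positivity) (by positivity), Real.log_mul (by positivity) (by positivity),
    Real.log_rpow hn']

lemma log_inv_le_log_rate (hβ₁ : 1 < β) (hβ₂ : β ≤ 2) (hd : 1 ≤ d) (hn : 1 ≤ n) (hε₀ : 0 < ε) :
    Real.log ε⁻¹ ≤ Real.log ((d : ℝ) * (n : ℝ) ^ (1 / β - 1 / 2) * ε⁻¹) := by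
  rw [log_rate_eq hd hn hε₀]
  have h1 := Real.log_natCast_nonneg d
  have h2 := mul_nonneg (exponent_mem hβ₁ hβ₂).1 (Real.log_natCast_nonneg n)
  linarith

lemma alpha₁_sq (hβ₁ : 1 < β) (hβ₂ : β ≤ 2) (hd : 1 ≤ d) (hn : 1 ≤ n) (hε₀ : 0 < ε)
    (hε : ε < 1 / 6) :
    n * alpha₁ β d n ε ^ 2 = Real.log ((d : ℝ) * (n : ℝ) ^ (1 / β - 1 / 2) * ε⁻¹) := by
  have h1 := one_lt_log_inv hε₀ hε
  have h2 := log_inv_le_log_rate hβ₁ hβ₂ hd hn hε₀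
  have hn' : (0 : ℝ) < n := Nat.cast_pos.2 hn
  rw [alpha₁, Real.sq_sqrt (div_nonneg (by linarith) hn'.le)]
  field_simp

lemma alpha₁_pos (hβ₁ : 1 < β) (hβ₂ : β ≤ 2) (hd : 1 ≤ d) (hn : 1 ≤ n) (hε₀ : 0 < ε)
    (hε : ε < 1 / 6) : 0 < alpha₁ β d n ε := by
  have h1 := one_lt_log_inv hε₀ hε
  have h2 := log_inv_le_log_rate hβ₁ hβ₂ hd hn hε₀
  have hn' : (0 : ℝ) < n := Nat.cast_pos.2 hn
  exact Real.sqrt_pos.2 (div_pos (by linarith) hn')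

lemma alpha₂_rpow (hβ₁ : 1 < β) (hn : 1 ≤ n) (hε₀ : 0 < ε) (hε : ε < 1 / 6) :
    0 < alpha₂ β n ε ∧ alpha₂ β n ε ^ β = Real.log ε⁻¹ / n ∧
      alpha₂ β n ε * alpha₂ β n ε ^ (β - 1) = Real.log ε⁻¹ / n ∧
      alpha₂ β n ε ^ (β - 1) = (Real.log ε⁻¹ / n) ^ (1 - 1 / β) := by
  have h1 := one_lt_log_inv hε₀ hε
  have hn' : (0 : ℝ) < n := Nat.cast_pos.2 hn
  have hpos : 0 < Real.log ε⁻¹ / n := div_pos (by linarith) hn'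
  have hα : 0 < alpha₂ β n ε := Real.rpow_pos_of_pos hpos _
  have hβ0 : β ≠ 0 := by linarith
  have e1 : alpha₂ β n ε ^ β = Real.log ε⁻¹ / n := by
    rw [alpha₂, ← Real.rpow_mul hpos.le, one_div_mul_cancel hβ0, Real.rpow_one]
  refine ⟨hα, e1, ?_, ?_⟩
  · rw [← e1, Real.rpow_sub_one hα.ne']
    field_simp
  · rw [alpha₂, ← Real.rpow_mul hpos.le]
    congr 1
    field_simp

/-- `α₂^{β - 1}` exceeds `α₁` at most by the factor `n^{1/β - 1/2}`. -/
lemma alpha₂_rpow_le (hβ₁ : 1 < β) (hβ₂ : β ≤ 2) (hd : 1 ≤ d) (hn : 1 ≤ n) (hε₀ : 0 < ε)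
    (hε : ε < 1 / 6) :
    alpha₂ β n ε ^ (β - 1) ≤ alpha₁ β d n ε * (n : ℝ) ^ (1 / β - 1 / 2) := by
  have h1 := one_lt_log_inv hε₀ hε
  have h2 := log_inv_le_log_rate hβ₁ hβ₂ hd hn hε₀
  have hn' : (0 : ℝ) < n := Nat.cast_pos.2 hn
  have hγ := exponent_mem hβ₁ hβ₂
  rw [(alpha₂_rpow hβ₁ hn hε₀ hε).2.2.2, alpha₁, Real.sqrt_eq_rpow]
  have h3 : (Real.log ε⁻¹ / n) ^ (1 - 1 / β) =
      Real.log ε⁻¹ ^ (1 - 1 / β) * ((n : ℝ) ^ (1 / β - 1 / 2) / (n : ℝ) ^ (1 / 2 : ℝ)) := by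
    rw [Real.div_rpow (by linarith) hn'.le, ← Real.rpow_sub hn', div_eq_mul_inv,
      ← Real.rpow_neg hn'.le]
    congr 2
    ring
  rw [h3, Real.div_rpow (by linarith) hn'.le]
  have h4 : Real.log ε⁻¹ ^ (1 - 1 / β) ≤
      Real.log ((d : ℝ) * (n : ℝ) ^ (1 / β - 1 / 2) * ε⁻¹) ^ (1 / 2 : ℝ) :=
    (Real.rpow_le_rpow_of_exponent_le h1.le (by linarith)).trans
      (Real.rpow_le_rpow (by linarith) h2 (by norm_num))
  calc _ ≤ Real.log ((d : ℝ) * (n : ℝ) ^ (1 / β - 1 / 2) * ε⁻¹) ^ (1 / 2 : ℝ) *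
        ((n : ℝ) ^ (1 / β - 1 / 2) / (n : ℝ) ^ (1 / 2 : ℝ)) :=
        mul_le_mul_of_nonneg_right h4 (by positivity)
    _ = _ := by ring

/-- Both parts of the rate are small when `n ≥ C d (log ε⁻¹ + 1)` with a large `C`. -/
lemma exists_rates_le (hβ₁ : 1 < β) (hβ₂ : β ≤ 2) {D ξ : ℝ} (hD : 1 ≤ D) (hξ : 0 < ξ) :
    ∃ C : ℝ, 1 ≤ C ∧ ∀ (d n : ℕ) (ε : ℝ), 1 ≤ d → (d : ℝ) ≤ D → 0 < ε → ε < 1 / 6 →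
      C * d * (Real.log ε⁻¹ + 1) ≤ n →
      √(d : ℝ) * alpha₁ β d n ε ≤ ξ ∧ alpha₂ β n ε ^ (β - 1) ≤ ξ := by
  set e := 1 - 1 / β with he
  have he0 : 0 < e := by
    have : 1 / β < 1 := by rw [div_lt_one (by linarith)]; linarith
    linarith
  -- The second entry makes √n large enough to absorb log n in the trend rate; the third makes (log
  -- ε⁻¹/n)^(1 - 1/β) at most ξ.
  set C := max 1 (max ((2 * D / ξ ^ 2) ^ 2) ((ξ⁻¹) ^ (1 / e))) with hC
  have hC1 : 1 ≤ C := le_max_left _ _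
  have hC2 : (2 * D / ξ ^ 2) ^ 2 ≤ C := (le_max_left _ _).trans (le_max_right _ _)
  have hC3 : (ξ⁻¹) ^ (1 / e) ≤ C := (le_max_right _ _).trans (le_max_right _ _)
  have hC0 : 0 < C := by linarith
  refine ⟨C, hC1, fun d n ε hd hdD hε₀ hε hn => ?_⟩
  have hΛ := one_lt_log_inv hε₀ hε
  set Λ := Real.log ε⁻¹ with hΛdef
  have hd1 : (1 : ℝ) ≤ d := by exact_mod_cast hd
  have hCd : C * (Λ + 1) ≤ n := by
    refine le_trans ?_ hn
    have : C ≤ C * d := le_mul_of_one_le_right hC0.le hd1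
    exact mul_le_mul_of_nonneg_right this (by linarith)
  have hCn : C ≤ n := le_trans (le_mul_of_one_le_right hC0.le (by linarith)) hCd
  have hn0 : (0 : ℝ) < n := by linarith
  have hn1 : 1 ≤ n := by
    have : (0 : ℝ) < n := hn0
    exact Nat.cast_pos.1 this
  constructor
  · rw [alpha₁, ← Real.sqrt_mul (by linarith), log_rate_eq hd hn1 hε₀]
    rw [Real.sqrt_le_left hξ.le, ← hΛdef]
    have hs : 2 * D / ξ ^ 2 ≤ √n := Real.le_sqrt_of_sq_le (hC2.trans hCn)
    have hs0 : 0 < √(n : ℝ) := Real.sqrt_pos.2 hn0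
    have hsq : √(n : ℝ) * √n = n := Real.mul_self_sqrt hn0.le
    have hγ := exponent_mem hβ₁ hβ₂
    have hlogn : Real.log n ≤ 2 * (√n - 1) := by
      have := Real.log_le_sub_one_of_pos hs0
      rw [Real.log_sqrt hn0.le] at this
      linarith
    have hlogn0 := Real.log_natCast_nonneg n
    have h1 : (1 / β - 1 / 2) * Real.log n ≤ √n := by nlinarith
    have h2 : Real.log d ≤ d := (Real.log_le_sub_one_of_pos (by linarith)).trans (by linarith)
    rw [← mul_div_assoc, div_le_iff₀ hn0]
    set k := 2 * D / ξ ^ 2 with hk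
    have hkD : ξ ^ 2 / 2 * k = D := by rw [hk]; field_simp
    have hkC : k ≤ C := by nlinarith [sq_nonneg (k - 1)]
    have h3 : k * (d * (Λ + 1)) ≤ n := by
      refine le_trans ?_ hn
      rw [mul_assoc C]
      exact mul_le_mul_of_nonneg_right hkC (by positivity)
    have h4 : k * √n ≤ n := (mul_le_mul_of_nonneg_right hs hs0.le).trans_eq hsq
    have h5 : D * (d * (Λ + 1)) ≤ ξ ^ 2 / 2 * n := by
      rw [← hkD, mul_assoc]; exact mul_le_mul_of_nonneg_left h3 (by positivity)
    have h6 : D * √n ≤ ξ ^ 2 / 2 * n := by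
      rw [← hkD, mul_assoc]; exact mul_le_mul_of_nonneg_left h4 (by positivity)
    have h7 : d * (d + Λ) ≤ D * (d * (Λ + 1)) := by
      have : d + Λ ≤ D * (Λ + 1) := by nlinarith
      nlinarith
    have h8 : d * √n ≤ D * √n := mul_le_mul_of_nonneg_right hdD hs0.le
    have h9 : (d : ℝ) * (Real.log d + (1 / β - 1 / 2) * Real.log n + Λ) ≤ d * (d + √n + Λ) :=
      mul_le_mul_of_nonneg_left (by linarith) (by linarith)
    linarith
  · rw [(alpha₂_rpow hβ₁ hn1 hε₀ hε).2.2.2]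
    have h1 : Λ / n ≤ C⁻¹ := by
      rw [div_le_iff₀ hn0, ← div_eq_inv_mul, le_div_iff₀ hC0]
      linarith
    have h2 : C⁻¹ ≤ ξ ^ (1 / e) := by
      rw [Real.inv_rpow hξ.le] at hC3
      exact inv_le_of_inv_le₀ (by positivity) hC3
    calc (Λ / n) ^ e ≤ (ξ ^ (1 / e)) ^ e :=
          Real.rpow_le_rpow (by positivity) (h1.trans h2) he0.le
      _ = ξ := by rw [← Real.rpow_mul hξ.le, one_div_mul_cancel he0.ne', Real.rpow_one]

end Rates

/-! ### Choice of the constants. -/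

/-- The constants: `K` bounds the logarithm of the number of constraints, `C₁` and `C₂` are the
constants of the two error bounds. -/
lemma exists_constants {A D N S B c : ℝ} (hA : 0 < A) (hD : 1 ≤ D) (hN : 0 ≤ N) (hB : 0 < B)
    (hc : 0 < c) :
    ∃ K C₁ C₂ : ℝ, 0 ≤ K ∧ 0 < C₁ ∧ 0 < C₂ ∧
      (N * (2 * C₂ * A + 1) + 1) * Real.exp (-K) ≤ Real.exp (-1) ∧ 1 ≤ K ∧
      32 * B * (K + 7) * D < c * C₁ ∧ 4 * B * C₁ ≤ C₂ ∧ 1 + S ≤ C₂ := by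
  -- The requirements are circular: K exceeds the logarithm of a cell count linear in C₂, C₁ is
  -- proportional to K + 7, and C₂ ≥ 4BC₁. The loop closes because C₂ enters it only through a
  -- logarithm.
  set a₁ := 4 * B * (33 * B * D / c) with ha₁
  have ha₁0 : 0 < a₁ := by positivity
  obtain ⟨C₂, hC₂, h⟩ := exists_add_mul_log_le (A₀ := |1 + S| + 8 * a₁) ha₁0
    (by positivity : 0 < N + 1) (by positivity : 0 < 2 * (N + 1) * A)
  set y := N + 1 + 2 * (N + 1) * A * C₂ with hy
  have hy1 : 1 ≤ y := by
    have : 0 ≤ 2 * (N + 1) * A * C₂ := by positivity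
    linarith
  have hlog : 0 ≤ Real.log y := Real.log_nonneg hy1
  have hal : 0 ≤ a₁ * Real.log y := by positivity
  refine ⟨1 + Real.log y, 33 * B * D / c * (8 + Real.log y), C₂, by linarith, by positivity, hC₂,
    ?_, by linarith, ?_, ?_, ?_⟩
  · rw [neg_add, Real.exp_add, Real.exp_neg (Real.log y), Real.exp_log (by linarith),
      mul_comm (Real.exp (-1)), ← mul_assoc]
    refine mul_le_of_le_one_left (Real.exp_pos _).le ?_
    rw [← div_eq_mul_inv, div_le_one (by linarith), hy]
    have : 0 ≤ 2 * A * C₂ := by positivity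
    linarith
  · have e : c * (33 * B * D / c * (8 + Real.log y)) = 33 * B * (1 + Real.log y + 7) * D := by
      field_simp; ring
    rw [e]
    have : 0 < B * (1 + Real.log y + 7) * D := by positivity
    linarith
  · have e : 4 * B * (33 * B * D / c * (8 + Real.log y)) = 8 * a₁ + a₁ * Real.log y := by
      rw [ha₁]; ring
    rw [e]
    linarith [abs_nonneg (1 + S)]
  · linarith [le_abs_self (1 + S)]

/-! ### Assembly. -/

lemma exists_event_of_isLinearModel {Ω : Type*} [MeasurableSpace Ω] {μ : Measure Ω}
    [IsProbabilityMeasure μ] {d n : ℕ} {β σ m : ℝ} (hβ₁ : 1 < β)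
    {θstar : EuclideanSpace ℝ (Fin d)} {x : Fin n → Ω → EuclideanSpace ℝ (Fin d)}
    {noise y : Fin n → Ω → ℝ} (h : IsLinearModel μ β σ m θstar x noise y)
    {T : Set ((Fin n → EuclideanSpace ℝ (Fin d)) × (Fin n → ℝ))} (hT : MeasurableSet T)
    {G : Set (Fin n → EuclideanSpace ℝ (Fin d))} {δ : ℝ}
    (hTG : ∀ u ∈ G, ∀ κ : Fin n → Measure ℝ, (∀ i, IsNoiseLaw β σ m (κ i)) →
      (Measure.pi κ).real {z | (u, z) ∈ T}ᶜ ≤ δ) :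
    MeasurableSet {ω | ((fun i => x i ω), (fun i => noise i ω)) ∈ T} ∧
      ∀ᵐ ω ∂μ, (fun i => x i ω) ∈ G → 1 - δ ≤
        (μ⟦{ω | ((fun i => x i ω), (fun i => noise i ω)) ∈ T} |
          MeasurableSpace.comap (fun ω' i => x i ω') inferInstance⟧) ω := by
  have hX : Measurable fun ω i => x i ω := measurable_pi_lambda _ h.measurable_design
  have hZ : Measurable fun ω i => noise i ω := measurable_pi_lambda _ h.measurable_noise
  refine ⟨(hX.prodMk hZ) hT, ?_⟩
  filter_upwards [condExp_indicator_eq_pi_condDistrib μ h.measurable_design h.measurable_noise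
    h.indep_noise hT, h.isNoiseLaw hβ₁] with ω h1 h2 hG
  rw [h1]
  have h3 := hTG _ hG _ h2
  have hm : MeasurableSet {z | ((fun i => x i ω), z) ∈ T} := measurable_prodMk_left hT
  rw [probReal_compl_eq_one_sub hm] at h3
  linarith

lemma rpow_neg_half_eq_inv_sqrt {t : ℝ} (ht : 0 < t) : t ^ (-(1 / 2) : ℝ) = (√t)⁻¹ := by
  rw [Real.rpow_neg ht.le, Real.sqrt_eq_rpow]

/-- One factor exp(-ℓ) = ε/(dν) cancels the coordinate and cell counts; as ℓ ≥ 1, what remains is at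
most exp(1 - K), which absorbs the constant 2Nq. -/
lemma card_mul_exp_neg_le {p N q K d ν M ε : ℝ} (hp0 : 0 ≤ p) (hp : p ≤ N) (hd : 0 < d)
    (hν : 0 < ν) (hε : 0 < ε) (hq : 0 ≤ q) (hM : M ≤ q * ν) (hK1 : 1 ≤ K)
    (hK : (2 * N * q + 1) * Real.exp (-K) ≤ Real.exp (-1))
    (hℓ : 1 ≤ Real.log (d * ν * ε⁻¹)) :
    p * (d * 2 * M) * Real.exp (-(K * Real.log (d * ν * ε⁻¹))) ≤ ε := by
  set ℓ := Real.log (d * ν * ε⁻¹) with hℓdef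
  have hexp : Real.exp (-ℓ) * (d * ν) = ε := by
    rw [Real.exp_neg, hℓdef, Real.exp_log (by positivity)]
    field_simp
  have h1 : Real.exp (-(K * ℓ)) ≤ Real.exp (-K) * Real.exp 1 * Real.exp (-ℓ) := by
    rw [← Real.exp_add, ← Real.exp_add, Real.exp_le_exp]
    nlinarith
  have h2 : 2 * N * q * (Real.exp (-K) * Real.exp 1) ≤ 1 := by
    have h3 := mul_le_mul_of_nonneg_right hK (Real.exp_pos 1).le
    rw [← Real.exp_add, neg_add_cancel, Real.exp_zero] at h3
    have : 0 ≤ Real.exp (-K) * Real.exp 1 := by positivity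
    linarith
  have hN : 0 ≤ N := hp0.trans hp
  calc p * (d * 2 * M) * Real.exp (-(K * ℓ))
      ≤ N * (d * 2 * (q * ν)) * (Real.exp (-K) * Real.exp 1 * Real.exp (-ℓ)) := by
        have : p * (d * 2 * M) ≤ N * (d * 2 * (q * ν)) :=
          (mul_le_mul_of_nonneg_left (by gcongr) hp0).trans
            (mul_le_mul_of_nonneg_right hp (by positivity))
        exact mul_le_mul this h1 (Real.exp_pos _).le (by positivity)
    _ = 2 * N * q * (Real.exp (-K) * Real.exp 1) * (Real.exp (-ℓ) * (d * ν)) := by ring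
    _ ≤ 1 * ε := by rw [hexp]; gcongr
    _ = ε := one_mul ε

/-- The number of cells of length `a` needed to cover an interval of length `2 C₂ δ`. -/
lemma exists_cell_count {a η A ν C₂ δ : ℝ} (ha : 0 < a) (ha' : a ≤ 1 / 2) (hη : η = C₂ * δ)
    (hη0 : 0 ≤ η) (hη' : η ≤ 1 / 2) (hC₂ : 0 < C₂) (hν : 1 ≤ ν) (hδ : δ ≤ A * ν * a) :
    ∃ M : ℕ, 2 * η < M * a ∧ 1 - η + M * a ≤ 2 ∧ (M : ℝ) ≤ (2 * C₂ * A + 1) * ν := by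
  have hMle := Nat.floor_le (by positivity : 0 ≤ 2 * η / a)
  -- The extra cell makes the covering strict; the right end is then at most 1 + η + a ≤ 2.
  refine ⟨⌊2 * η / a⌋₊ + 1, ?_, ?_, ?_⟩
  · have := Nat.lt_floor_add_one (2 * η / a)
    rw [div_lt_iff₀ ha] at this
    push_cast
    exact this
  · rw [le_div_iff₀ ha] at hMle
    push_cast
    linarith
  · have h4 : 2 * η / a ≤ 2 * C₂ * A * ν := by
      rw [div_le_iff₀ ha, hη]
      have := mul_le_mul_of_nonneg_left hδ (by positivity : 0 ≤ 2 * C₂)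
      linarith
    push_cast
    linarith

/-- Translation of a solution in the variables `τ = σ / v`, `h = θ - θstar` to the coupled
equations. -/
lemma solution_of_rescaled {d n : ℕ} {ψ₁ ψ₂ : ℝ → ℝ} {a α σ τ η : ℝ} (hσ : 0 < σ)
    (hη0 : 0 ≤ η) (hη : η ≤ 1 / 2) (hτ : τ ∈ Set.Icc (√(1 - η)) (√(1 + η)))
    {x : Fin n → EuclideanSpace ℝ (Fin d)} {y z : Fin n → ℝ} {θ h : EuclideanSpace ℝ (Fin d)}
    (hy : ∀ i, y i = inner ℝ (x i) θ + z i)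
    (e₁ : ∑ i, ψ₁ (a / σ * τ * (z i - inner ℝ (x i) h)) • x i = 0)
    (e₂ : ∑ i, ψ₂ (α * (τ ^ 2 * ((z i - inner ℝ (x i) h) ^ 2 / σ ^ 2) - 1)) = 0) :
    trendEq ψ₁ a x y (θ + h) (σ / τ) = 0 ∧ scaleEq ψ₂ α x y (θ + h) (σ / τ) = 0 ∧
      (1 + η) ^ (-(1 / 2) : ℝ) * σ ≤ σ / τ ∧ σ / τ ≤ (1 - η) ^ (-(1 / 2) : ℝ) * σ := by
  have hτ0 : 0 < τ := (Real.sqrt_pos.2 (by linarith : 0 < 1 - η)).trans_le hτ.1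
  have hres : ∀ i, y i - inner ℝ (x i) (θ + h) = z i - inner ℝ (x i) h := by
    intro i
    rw [hy, inner_add_right]; ring
  refine ⟨?_, ?_, ?_, ?_⟩
  · have : ∀ i, a * ((y i - inner ℝ (x i) (θ + h)) / (σ / τ)) =
        a / σ * τ * (z i - inner ℝ (x i) h) := fun i => by
      rw [hres]; field_simp
    simp only [trendEq, this]
    rw [e₁, smul_zero]
  · have : ∀ i, α * ((y i - inner ℝ (x i) (θ + h)) ^ 2 / (σ / τ) ^ 2 - 1) =
        α * (τ ^ 2 * ((z i - inner ℝ (x i) h) ^ 2 / σ ^ 2) - 1) := fun i => by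
      rw [hres]; field_simp
    simp only [scaleEq, this]
    rw [e₂, mul_zero]
  · rw [rpow_neg_half_eq_inv_sqrt (by linarith), inv_mul_eq_div]
    exact div_le_div_of_nonneg_left hσ.le hτ0 hτ.2
  · rw [rpow_neg_half_eq_inv_sqrt (by linarith), inv_mul_eq_div]
    exact div_le_div_of_nonneg_left hσ.le (Real.sqrt_pos.2 (by linarith)) hτ.1

/-- The conclusion of the theorem for fixed `d`, `n`, `ε` and fixed admissible constants. -/
lemma exists_event_of_rates_le {β σ m c_l c_u L B D N₀ K C₁ C₂ ξ : ℝ} (hβ₁ : 1 < β) (hβ₂ : β ≤ 2)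
    (hσ : 0 < σ) (hc_l : 0 < c_l) (hB : 0 < B) (hLB : L ≤ B) (hK : 0 ≤ K) (hC₁ : 0 < C₁)
    (hC₂ : 0 < C₂)
    (hKexp : (2 * N₀ * (2 * C₂ * (√D + 1) + 1) + 1) * Real.exp (-K) ≤ Real.exp (-1))
    (hK1 : 1 ≤ K) (hKC₁ : 32 * B * (K + 7) * D < c_l * C₁) (hC₁₂ : 4 * B * C₁ ≤ C₂)
    (hSC₂ : 1 + scaleConst β σ m ≤ C₂) (hξ1 : C₂ * ξ ≤ 1 / 4) (hξ2 : B * C₁ * ξ ≤ 1)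
    (hξ3 : ξ ≤ 1 / 2) {d n : ℕ} {ε : ℝ} (hd : 1 ≤ d) (hε₀ : 0 < ε) (hε : ε < 1 / 6) (hn1 : 1 ≤ n)
    (hdD : (d : ℝ) ≤ D) (hr₁ : √(d : ℝ) * alpha₁ β d n ε ≤ ξ) (hr₂ : alpha₂ β n ε ^ (β - 1) ≤ ξ)
    {P : Finset (EuclideanSpace ℝ (Fin d))} (hP : ∀ p ∈ P, ‖p‖ ≤ 1)
    (hnet : ∀ u : EuclideanSpace ℝ (Fin d), ‖u‖ = 1 → ∃ p ∈ P,
      B ^ 2 * ‖p - (1 / 2 : ℝ) • u‖ ^ 2 ≤ c_l / 9) (hcardN : (P.card : ℝ) ≤ N₀)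
    {ψ₁ ψ₂ : ℝ → ℝ} (hψ₁ : IsCatoniFunction 2 ψ₁) (hψ₂ : IsCatoniFunction β ψ₂)
    {Ω : Type*} [MeasurableSpace Ω] (μ : Measure Ω) [IsProbabilityMeasure μ]
    (θstar : EuclideanSpace ℝ (Fin d)) (x : Fin n → Ω → EuclideanSpace ℝ (Fin d))
    (noise y : Fin n → Ω → ℝ) (hmodel : IsLinearModel μ β σ m θstar x noise y) :
      ∃ E : Set Ω, MeasurableSet E ∧
        (∀ᵐ ω ∂μ, IsGoodDesign c_l c_u L (fun i => x i ω) →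
          1 - 6 * ε ≤
            (μ⟦E | MeasurableSpace.comap (fun ω' i => x i ω') inferInstance⟧) ω) ∧
        ∀ ω ∈ E, ∃ (θhat : EuclideanSpace ℝ (Fin d)) (vhat : ℝ),
          trendEq ψ₁ (alpha₁ β d n ε)
              (fun i => x i ω) (fun i => y i ω) θhat vhat = 0 ∧
          scaleEq ψ₂ (alpha₂ β n ε)
              (fun i => x i ω) (fun i => y i ω) θhat vhat = 0 ∧
          ‖θhat - θstar‖ ≤
            C₁ * σ *
              √((d : ℝ) * Real.log ((d : ℝ) * (n : ℝ) ^ (1 / β - 1 / 2) * ε⁻¹) / (n : ℝ)) ∧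
          C₂ * scaleRate β d n ε < 1 ∧
          (1 + C₂ * scaleRate β d n ε) ^ (-(1 / 2) : ℝ) * σ ≤ vhat ∧
          vhat ≤ (1 - C₂ * scaleRate β d n ε) ^ (-(1 / 2) : ℝ) * σ := by
  have hΛ := one_lt_log_inv hε₀ hε
  have hd1 : (1 : ℝ) ≤ d := by exact_mod_cast hd
  have hn0 : (0 : ℝ) < n := Nat.cast_pos.2 hn1
  obtain ⟨hα0, hαβ, hαβ', -⟩ := alpha₂_rpow hβ₁ hn1 hε₀ hε
  have ha0 := alpha₁_pos hβ₁ hβ₂ hd hn1 hε₀ hε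
  have hasq := alpha₁_sq hβ₁ hβ₂ hd hn1 hε₀ hε
  have hα₂le := alpha₂_rpow_le hβ₁ hβ₂ hd hn1 hε₀ hε
  set a := alpha₁ β d n ε with hadef
  set α := alpha₂ β n ε with hαdef
  set ν := (n : ℝ) ^ (1 / β - 1 / 2) with hν
  have hν1 : 1 ≤ ν := Real.one_le_rpow (by exact_mod_cast hn1) (exponent_mem hβ₁ hβ₂).1
  have hδdef : scaleRate β d n ε = √(d : ℝ) * a + α ^ (β - 1) := rfl
  set δ := scaleRate β d n ε with hδ
  have hsd1 : 1 ≤ √(d : ℝ) := Real.one_le_sqrt.2 hd1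
  have hαβ0 : 0 ≤ α ^ (β - 1) := Real.rpow_nonneg hα0.le _
  have hδ0 : 0 ≤ δ := by rw [hδdef]; positivity
  set η := C₂ * δ with hηdef
  have hη0 : 0 ≤ η := by positivity
  have hη : η ≤ 1 / 2 := by
    have : C₂ * δ ≤ C₂ * (ξ + ξ) := mul_le_mul_of_nonneg_left (by linarith) hC₂.le
    linarith
  have hasd : a ≤ √(d : ℝ) * a := le_mul_of_one_le_left ha0.le hsd1
  set ρ := C₁ * σ * (√(d : ℝ) * a) with hρdef
  have hρ0 : 0 < ρ := by positivity
  have hBρ : B * ρ ≤ σ := by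
    have h1 : B * C₁ * (√(d : ℝ) * a) ≤ 1 :=
      (mul_le_mul_of_nonneg_left hr₁ (by positivity)).trans hξ2
    calc B * ρ = B * C₁ * (√(d : ℝ) * a) * σ := by rw [hρdef]; ring
      _ ≤ 1 * σ := by gcongr
      _ = σ := one_mul σ
  have hρeq : C₁ * σ * √((d : ℝ) * Real.log ((d : ℝ) * ν * ε⁻¹) / (n : ℝ)) = ρ := by
    rw [hρdef, hadef, alpha₁, ← Real.sqrt_mul (Nat.cast_nonneg d), mul_div_assoc]
  obtain ⟨M, hM1, hM2, hMν⟩ := exists_cell_count (A := √D + 1) (δ := δ) ha0 (by linarith) hηdef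
    hη0 hη hC₂ hν1 (by
      rw [hδdef]
      have h3 : √(d : ℝ) * a ≤ √D * ν * a := by
        refine mul_le_mul_of_nonneg_right ((Real.sqrt_le_sqrt hdD).trans ?_) ha0.le
        exact le_mul_of_one_le_right (Real.sqrt_nonneg _) hν1
      linarith)
  set ℓ := Real.log ((d : ℝ) * ν * ε⁻¹) with hℓ
  have hℓ1 : 1 ≤ ℓ := hΛ.le.trans (log_inv_le_log_rate hβ₁ hβ₂ hd hn1 hε₀)
  have hcard : P.card * (d * 2 * M) * Real.exp (-(K * ℓ)) ≤ ε :=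
    card_mul_exp_neg_le (Nat.cast_nonneg _) hcardN (by linarith) (by linarith) hε₀ (by positivity)
      hMν hK1 hKexp hℓ1
  -- The two parts of η have separate duties: C₂ α₂^(β-1) pays for the deviation and the moment
  -- term, C₂ √d α₁ for the displacement Bρ.
  have hl : Real.log ε⁻¹ / n + α ^ β * scaleConst β σ m ≤ α * (η - 4 * (B * ρ / σ)) := by
    have e1 : B * ρ / σ = B * C₁ * (√(d : ℝ) * a) := by rw [hρdef]; field_simp
    rw [hαβ, ← hαβ', e1, hηdef, hδdef]
    have h1 := mul_le_mul_of_nonneg_right hSC₂ (mul_nonneg hα0.le hαβ0)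
    have h2 := mul_le_mul_of_nonneg_right hC₁₂ (by positivity : 0 ≤ α * (√(d : ℝ) * a))
    linarith
  have hlε : Real.exp (-(n * (Real.log ε⁻¹ / n))) ≤ ε := by
    rw [mul_div_cancel₀ _ hn0.ne', Real.log_inv, neg_neg, Real.exp_log hε₀]
  obtain ⟨hE, hprob⟩ := exists_event_of_isLinearModel hβ₁ hmodel
    (measurableSet_solutionEvent hψ₁.continuous hψ₂.continuous c_l B a α σ ρ (K * ℓ) η M P)
    (G := {u | IsSpreadDesign c_l B u}) (δ := 3 * ε) (fun u hu κ hκ => by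
      have := fun i => (hκ i).prob
      exact real_compl_solutionEvent_le hβ₁ hβ₂ hσ hκ hψ₁ hψ₂ hB ha0.le hα0.le hρ0.le hBρ hη0 hη
        hM2 hP hcard hl hlε hu)
  refine ⟨_, hE, ?_, ?_⟩
  · filter_upwards [hprob] with ω hω hgood
    linarith [hω (hgood.isSpreadDesign hn1 hLB)]
  · rintro ω ⟨hx, htrend, hlower, hupper⟩
    have hρK : 32 * B * (K + 7) * d * σ * a < c_l * ρ := by
      have h1 : 32 * B * (K + 7) * d ≤ 32 * B * (K + 7) * D := by gcongr
      have h2 : 32 * B * (K + 7) * d < c_l * C₁ := h1.trans_lt hKC₁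
      have h3 := mul_lt_mul_of_pos_right h2 (mul_pos hσ ha0)
      have h4 := mul_le_mul_of_nonneg_left hasd (by positivity : 0 ≤ c_l * C₁ * σ)
      rw [hρdef]
      linarith
    obtain ⟨τ, hτ, h, hh, e₁, e₂⟩ := exists_solution_of_event hψ₁.continuous hψ₁.monotone
      hψ₂.continuous hψ₂.monotone hn1 hc_l hB hσ ha0 hα0.le hρ0 hBρ hη0 hη hK hρK hM1 hP
      hnet hx htrend (by rw [mul_assoc, hasq]) hlower hupper
    obtain ⟨s₁, s₂, s₃, s₄⟩ := solution_of_rescaled hσ hη0 hη hτ (fun i => hmodel.model i ω) e₁ e₂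
    exact ⟨θstar + h, σ / τ, s₁, s₂, by rw [add_sub_cancel_left, hρeq]; exact hh, by linarith, s₃,
      s₄⟩

end JointRegression

open JointRegression in
theorem theorem2p2
    (β σ m c_l c_u L : ℝ) (hβ₁ : 1 < β) (hβ₂ : β ≤ 2) (hσ : 0 < σ)
    (hc_l : 0 < c_l) (hc_u : 0 < c_u) :
    ∃ C C₁ C₂ : ℝ, 0 < C ∧ 0 < C₁ ∧ 0 < C₂ ∧
      ∀ (d n : ℕ) (ε : ℝ), 1 ≤ d → 0 < ε → ε < 1 / 6 →
        C * (d : ℝ) * (Real.log ε⁻¹ + 1) ≤ (n : ℝ) →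
      -- the rate written out
      JointRegression.scaleRate β d n ε =
          √((d : ℝ) * Real.log ((d : ℝ) * (n : ℝ) ^ (1 / β - 1 / 2) * ε⁻¹) / (n : ℝ)) +
            (Real.log ε⁻¹ / (n : ℝ)) ^ ((β - 1) / β) ∧
      ∀ (ψ₁ ψ₂ : ℝ → ℝ),
        JointRegression.IsCatoniFunction 2 ψ₁ → JointRegression.IsCatoniFunction β ψ₂ →
      ∀ {Ω : Type*} [MeasurableSpace Ω] (μ : Measure Ω) [IsProbabilityMeasure μ]
        (θstar : EuclideanSpace ℝ (Fin d))
        (x : Fin n → Ω → EuclideanSpace ℝ (Fin d)) (noise y : Fin n → Ω → ℝ),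
        JointRegression.IsLinearModel μ β σ m θstar x noise y →
      ∃ E : Set Ω, MeasurableSet E ∧
        -- given the design, `E` has probability at least `1 - 6ε` wherever the design is good
        (∀ᵐ ω ∂μ, JointRegression.IsGoodDesign c_l c_u L (fun i => x i ω) →
          1 - 6 * ε ≤
            (μ⟦E | MeasurableSpace.comap (fun ω' i => x i ω') inferInstance⟧) ω) ∧
        -- on `E` the coupled equations have a solution within the stated bounds
        ∀ ω ∈ E, ∃ (θhat : EuclideanSpace ℝ (Fin d)) (vhat : ℝ),
          JointRegression.trendEq ψ₁ (JointRegression.alpha₁ β d n ε)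
              (fun i => x i ω) (fun i => y i ω) θhat vhat = 0 ∧
          JointRegression.scaleEq ψ₂ (JointRegression.alpha₂ β n ε)
              (fun i => x i ω) (fun i => y i ω) θhat vhat = 0 ∧
          ‖θhat - θstar‖ ≤
            C₁ * σ *
              √((d : ℝ) * Real.log ((d : ℝ) * (n : ℝ) ^ (1 / β - 1 / 2) * ε⁻¹) / (n : ℝ)) ∧
          C₂ * JointRegression.scaleRate β d n ε < 1 ∧
          (1 + C₂ * JointRegression.scaleRate β d n ε) ^ (-(1 / 2) : ℝ) * σ ≤ vhat ∧
          vhat ≤ (1 - C₂ * JointRegression.scaleRate β d n ε) ^ (-(1 / 2) : ℝ) * σ := by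
  -- L may be zero or negative, while B is divided by.
  obtain ⟨B, hBdef⟩ : ∃ B, B = |L| + 1 := ⟨_, rfl⟩
  have hB : 0 < B := by rw [hBdef]; positivity
  have hLB : L ≤ B := by linarith [le_abs_self L]
  choose P hP hnet using fun d => exists_half_net d hc_l hB
  obtain ⟨D, hDdef⟩ : ∃ D, D = max 1 (B ^ 2 / c_l) := ⟨_, rfl⟩
  have hD : 1 ≤ D := hDdef ▸ le_max_left _ _
  -- Bounds the net cardinalities in all admissible dimensions at once.
  obtain ⟨N₀, hN₀⟩ : ∃ N₀, N₀ = ∑ k ∈ Finset.range (⌊D⌋₊ + 1), ((P k).card : ℝ) := ⟨_, rfl⟩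
  have hN₀0 : 0 ≤ N₀ := hN₀ ▸ Finset.sum_nonneg fun _ _ => Nat.cast_nonneg _
  obtain ⟨K, C₁, C₂, hK, hC₁, hC₂, hKexp, hK1, hKC₁, hC₁₂, hSC₂⟩ := exists_constants
    (A := √D + 1) (D := D) (N := 2 * N₀) (S := scaleConst β σ m) (by positivity) hD (by positivity)
    hB hc_l
  -- The three caps ensure η ≤ 1/2, Bρ ≤ σ and α₁ ≤ 1/2.
  obtain ⟨ξ, hξdef⟩ : ∃ ξ, ξ = min (1 / (4 * C₂)) (min (1 / (B * C₁)) (1 / 2)) := ⟨_, rfl⟩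
  have hξ1 : C₂ * ξ ≤ 1 / 4 := by
    have : ξ ≤ 1 / (4 * C₂) := hξdef ▸ min_le_left _ _
    calc C₂ * ξ ≤ C₂ * (1 / (4 * C₂)) := by gcongr
      _ = 1 / 4 := by field_simp
  have hξ2 : B * C₁ * ξ ≤ 1 := by
    have : ξ ≤ 1 / (B * C₁) := hξdef ▸ (min_le_right _ _).trans (min_le_left _ _)
    calc B * C₁ * ξ ≤ B * C₁ * (1 / (B * C₁)) := by gcongr
      _ = 1 := by field_simp
  have hξ3 : ξ ≤ 1 / 2 := hξdef ▸ (min_le_right _ _).trans (min_le_right _ _)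
  have hξ : 0 < ξ := by rw [hξdef]; positivity
  obtain ⟨C, hC, hrates⟩ := exists_rates_le hβ₁ hβ₂ hD hξ
  refine ⟨C, C₁, C₂, by linarith, hC₁, hC₂, fun d n ε hd hε₀ hε hn =>
    ⟨scaleRate_eq hε₀ hε, fun ψ₁ ψ₂ hψ₁ hψ₂ Ω _ μ _ θstar x noise y hmodel => ?_⟩⟩
  have hΛ := one_lt_log_inv hε₀ hε
  have hd1 : (1 : ℝ) ≤ d := by exact_mod_cast hd
  have hn1 : 1 ≤ n := by
    have : (0 : ℝ) < n := lt_of_lt_of_le (by positivity) hn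
    exact Nat.cast_pos.1 this
  by_cases hdD : (d : ℝ) ≤ D
  swap
  -- In dimensions above D no design is good, so the empty event satisfies both claims.
  · refine ⟨∅, MeasurableSet.empty, Filter.Eventually.of_forall fun ω hgood => ?_,
      fun ω hω => hω.elim⟩
    refine absurd ?_ hdD
    have := (hgood.isSpreadDesign hn1 hLB).dim_mul_le hn1
    rw [← le_div_iff₀ hc_l] at this
    exact this.trans (hDdef ▸ le_max_right _ _)
  obtain ⟨hr₁, hr₂⟩ := hrates d n ε hd hdD hε₀ hε hn
  exact exists_event_of_rates_le hβ₁ hβ₂ hσ hc_l hB hLB hK hC₁ hC₂ hKexp hK1 hKC₁ hC₁₂ hSC₂ hξ1 hξ2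
    hξ3 hd hε₀ hε hn1 hdD hr₁ hr₂ (hP d) (hnet d) (hN₀ ▸
      Finset.single_le_sum (f := fun k => ((P k).card : ℝ)) (fun _ _ => Nat.cast_nonneg _)
      (Finset.mem_range.2 (Nat.lt_succ_of_le (Nat.le_floor hdD)))) hψ₁ hψ₂ μ θstar x noise y hmodel
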